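/- **Conventions.** Let $X=2^{\mathbb N}$ or $X=\mathbb N^{\mathbb N}$ with the product topology. For a finite word $w$ let $wX$ be the set of all sequences in $X$ that extend $w$; the *basic open sets* are $\emptyset$ and the sets $wX$. A sequence $(A_i)$ of closed subsets of $X$ is - *computable in $\mathcal A_-(X)$* if there is a computable double sequence $(B_{i,n})$ of (codes of) basic open sets with $A_i=X\setminus\bigcup_n B_{i,n}$ for all $i$; - *computable in $\mathcal A_-(X)'$* if there is a computable triple sequence $(B_{i,k,n})$ of (codes of) basic open sets such that for all $i,n$ the codes $B_{i,k,n}$ are eventually constant in $k$, with limit $B_{i,n}$, and $A_i=X\setminus\bigcup_n B_{i,n}$ for all $i$; - *computable in $\mathcal A_+(X)$* if there is a computable double sequence $(x_{i,n})$ in $X\sqcup\{\infty\}$ with $A_i=\overline{\{x_{i,n}:n\in\mathbb N\}\cap X}$ for all $i$, the closure being taken in $X$. A set $A\subseteq X$ is *c.e. comeager*, *co-c.e. comeager* or *c.e. comeager in the limit* if $X\setminus A=\bigcup_{i}A_i$ for a sequence $(A_i)$ of nowhere dense closed sets that is computable in $\mathcal A_-(X)$, $\mathcal A_+(X)$ or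 $\mathcal A_-(X)'$, respectively. A set $U\subseteq 2^{\mathbb N}$ is *c.e. open in* $q\in2^{\mathbb N}$ if it is the union of a sequence of basic open sets whose codes are computable with oracle $q$. A point $p\in2^{\mathbb N}$ is *1-generic* if there is a computable $q\in 2^{\mathbb N}$ such that for every $U$ that is c.e. open in $q$ there is a finite prefix $w$ of $p$ with $w2^{\mathbb N}\subseteq U$ or $w2^{\mathbb N}\cap U=\emptyset$. A point is *computable in the limit* if it is the limit of a computable sequence of points. A point $p\in 2^{\mathbb N}$ has *minimal Turing degree* if it is not computable and every $q\in2^{\mathbb N}$ with $q\le_{\mathrm T}p$ is computable or satisfies $p\le_{\mathrm T}q$. **Corollary 9.8.** Let $A,B\subseteq2^{\mathbb N}$. 1. The whole space $2^{\mathbb N}$ is c.e. comeager, co-c.e. comeager and c.e. comeager in the limit; the same holds for $\mathbb N^{\mathbb N}$ as a subset of itself. 2. If $A$ is c.e. comeager, then $A$ contains a set of computable points that is dense in $2^{\mathbb N}$, and $A$ contains all 1-generic points. 3. If $A$ is c.e. comeager in the limit, then $A$ contains a set that is dense in $2^{\mathbb N}$ and consists of 1-generic points which are computable in the limit. 4.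 If $A$ is c.e. comeager, then $A$ contains a set that is co-c.e. comeager. 5. If $A$ is c.e. comeager or co-c.e. comeager, then $A$ is also c.e. comeager in the limit. 6. If $A$ and $B$ are both c.e. comeager, both co-c.e. comeager, or both c.e. comeager in the limit, then $A\cap B$ has the respective property. 7. The set of 1-generic points is c.e. comeager in the limit. 8. The set of non-computable points of $2^{\mathbb N}$ is co-c.e. comeager. 9. There is a co-c.e. comeager set $C\subseteq 2^{\mathbb N}$ that only contains 1-generic points; in particular, $C$ contains no points of minimal Turing degree. -/

import Mathlib

open Filter Topology

namespace EffCat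

section SequenceSpace

/- The space `ℕ → α` of sequences over a countable discrete alphabet `α`, with the product topology.
`α = Bool` gives Cantor space, `α = ℕ` gives Baire space. -/
variable {α : Type} [Primcodable α] [TopologicalSpace α]

/-- The set of all infinite sequences that extend the finite word `w`. -/
def cylinder (w : List α) : Set (ℕ → α) :=
  {x | ∀ (i : ℕ) (h : i < w.length), x i = w[i]}

/-- The standard basic open sets: the empty set and the cylinders. -/
def basicOpen : Option (List α) → Set (ℕ → α)
  | none => ∅
  | some w => cylinder w

/-- The closed set given by negative information: the name `p` lists basic open sets that exhaust
the complement. -/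
def negClosed (p : ℕ → Option (List α)) : Set (ℕ → α) :=
  (⋃ n, basicOpen (p n))ᶜ

/-- The closed set given by positive information: the name is a sequence of points of the coproduct
of the space with a dummy point `∞`. The `n`-th entry is the point `x n` if `d n = true`, and it
is `∞` if `d n = false`. The named set is the closure of the set of listed points other than `∞`. -/
def posClosed (d : ℕ → Bool) (x : ℕ → ℕ → α) : Set (ℕ → α) :=
  closure {y | ∃ n, d n = true ∧ y = x n}

/-- Computable sequences of closed sets with respect to negative information. -/
def ComputableNegSeq (A : ℕ → Set (ℕ → α)) : Prop :=
  ∃ p : ℕ → ℕ → Option (List α),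
    Computable (fun t : ℕ × ℕ => p t.1 t.2) ∧ ∀ i, A i = negClosed (p i)

/-- Computable sequences of closed sets with respect to positive information. -/
def ComputablePosSeq (A : ℕ → Set (ℕ → α)) : Prop :=
  ∃ (d : ℕ → ℕ → Bool) (x : ℕ → ℕ → ℕ → α),
    Computable (fun t : ℕ × ℕ => d t.1 t.2) ∧
    Computable (fun t : ℕ × ℕ × ℕ => x t.1 t.2.1 t.2.2) ∧
    ∀ i, A i = posClosed (d i) (x i)

/-- Computable sequences of closed sets with respect to the jump of negative information: the
`i`-th set is given by a sequence `p i 0, p i 1, …` which converges (pointwise, in the product of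
discrete spaces) to a name `r i` of the set by negative information. -/
def ComputableNegLimSeq (A : ℕ → Set (ℕ → α)) : Prop :=
  ∃ (p : ℕ → ℕ → ℕ → Option (List α)) (r : ℕ → ℕ → Option (List α)),
    Computable (fun t : ℕ × ℕ × ℕ => p t.1 t.2.1 t.2.2) ∧
    (∀ i n, ∀ᶠ k in atTop, p i k n = r i n) ∧
    ∀ i, A i = negClosed (r i)

/-- c.e. comeager sets. -/
def CEComeager (A : Set (ℕ → α)) : Prop :=
  ∃ S : ℕ → Set (ℕ → α),
    ComputableNegSeq S ∧ (∀ i, IsNowhereDense (S i)) ∧ Aᶜ = ⋃ i, S i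

/-- co-c.e. comeager sets. -/
def CoCEComeager (A : Set (ℕ → α)) : Prop :=
  ∃ S : ℕ → Set (ℕ → α),
    ComputablePosSeq S ∧ (∀ i, IsNowhereDense (S i)) ∧ Aᶜ = ⋃ i, S i

/-- Sets that are c.e. comeager in the limit. -/
def CEComeagerInLimit (A : Set (ℕ → α)) : Prop :=
  ∃ S : ℕ → Set (ℕ → α),
    ComputableNegLimSeq S ∧ (∀ i, IsNowhereDense (S i)) ∧ Aᶜ = ⋃ i, S i

end SequenceSpace

/-- A point of Cantor space as a (total) oracle. -/
def oracle (q : ℕ → Bool) : ℕ →. ℕ := fun n => Part.some (q n).toNat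

/-- `U` is c.e. open in `q`: it is the union of a sequence of basic open sets that is computable
with oracle `q`. -/
def CEOpenIn (q : ℕ → Bool) (U : Set (ℕ → Bool)) : Prop :=
  ∃ f : ℕ → Option (List Bool), ComputableIn {oracle q} f ∧ U = ⋃ n, basicOpen (f n)

/-- `p` is 1-generic in `q`. -/
def OneGenericIn (p q : ℕ → Bool) : Prop :=
  ∀ U : Set (ℕ → Bool), CEOpenIn q U →
    ∃ w : List Bool, p ∈ cylinder w ∧ (cylinder w ⊆ U ∨ cylinder w ∩ U = ∅)

/-- `p` is 1-generic if it is 1-generic in some computable `q`. -/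
def OneGeneric (p : ℕ → Bool) : Prop :=
  ∃ q : ℕ → Bool, Computable q ∧ OneGenericIn p q

/-- `p` is computable in the limit: it is the limit of a computable sequence of points. -/
def LimitComputable (p : ℕ → Bool) : Prop :=
  ∃ g : ℕ → ℕ → Bool,
    Computable (fun t : ℕ × ℕ => g t.1 t.2) ∧ ∀ n, ∀ᶠ k in atTop, g k n = p n

/-- `p` has minimal Turing degree: it is not computable, and every `q` that is Turing reducible to
`p` is computable or Turing equivalent to `p`. -/
def HasMinimalDegree (p : ℕ → Bool) : Prop :=
  ¬ Computable p ∧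
    ∀ q : ℕ → Bool, TuringReducible (oracle q) (oracle p) →
      Computable q ∨ TuringReducible (oracle p) (oracle q)

end EffCat

open EffCat

/-!
The facts about 1-genericity rest on the universal enumeration `ceOpen e` of the c.e. open
subsets of Cantor space. A point is 1-generic if and only if it lies on the boundary
of no `ceOpen e` (`oneGeneric_iff_frontier`); computable oracles do not matter here.

* The complement of the boundary of a c.e. open set `U` consists of `U` and of the cylinders disjoint
  from `U`. The latter are recognized with one limit, so the 1-generic points form a set that is
  c.e. comeager in the limit (`ceComeagerInLimit_oneGeneric`).
* A c.e. open set `U` has a computable partition into cylinders. Mark one computable point in each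
  of them. The markers accumulate at every boundary point of `U`, while each cylinder of the partition
  contains a single one; so their closure is nowhere dense, covers the boundary, and is given by
  positive information. This yields a co-c.e. comeager set of 1-generic points
  (`exists_coCEComeager_oneGeneric`). As each c.e. comeager set contains all 1-generic points, it also
  yields a co-c.e. comeager subset of any c.e. comeager set.
* Dense sets of computable or limit computable points come from the usual proof of the Baire category
  theorem, with the extensions found by unbounded search (`CEComeager.exists_computable`) or
  approximated by bounded searches (`CEComeagerInLimit.exists_limitComputable`). For 1-generic points,
  the latter is applied to the intersection with the set of all 1-generic points.
* Each computable point is the limit of the points obtained by running a program for it for `n` steps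
  and continuing with zeros. For an arbitrary program these points converge as well, and to a computable
  point. So the computable points are covered by closed sets, each consisting of countably many
  computable points only (`coCEComeager_noncomputable`).
* A 1-generic point `p` does not have minimal degree: its even part is not computable, and by the use
  principle for oracle computations (`exists_approximates`) it does not compute `p`.
-/

namespace EffCat

/-! ### Words, cylinders and the topology of Cantor space -/

/-- The prefix of length `k` of a sequence. -/
def initial {α : Type} (x : ℕ → α) (k : ℕ) : List α := (List.range k).map x

lemma isNowhereDense_frontier {X : Type} [TopologicalSpace X] {U : Set X} (hU : IsOpen U) :
    IsNowhereDense (frontier U) := by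
  rw [isClosed_frontier.isNowhereDense_iff, ← frontier_compl]
  exact interior_frontier hU.isClosed_compl

section Words

variable {α : Type}

@[simp] lemma length_initial (x : ℕ → α) (k : ℕ) : (initial x k).length = k := by
  simp [initial]

lemma initial_getElem? (x : ℕ → α) {k i : ℕ} (h : i < k) : (initial x k)[i]? = some (x i) := by
  simp [initial, h]

lemma mem_cylinder_iff_getElem? {x : ℕ → α} {w : List α} :
    x ∈ cylinder w ↔ ∀ i < w.length, w[i]? = some (x i) := by
  refine forall_congr' fun i => forall_congr' fun h => ?_
  rw [List.getElem?_eq_getElem h, Option.some.injEq, eq_comm]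

lemma mem_cylinder_iff_initial {x : ℕ → α} {w : List α} :
    x ∈ cylinder w ↔ initial x w.length = w := by
  rw [mem_cylinder_iff_getElem?]
  constructor
  · intro h
    refine List.ext_getElem? fun i => ?_
    by_cases hi : i < w.length
    · rw [initial_getElem? x hi, h i hi]
    · rw [List.getElem?_eq_none (by simpa using hi), List.getElem?_eq_none (by simpa using hi)]
  · intro h i hi
    conv_lhs => rw [← h]
    exact initial_getElem? x hi

lemma mem_cylinder_initial_iff {x y : ℕ → α} {k : ℕ} :
    y ∈ cylinder (initial x k) ↔ ∀ i < k, y i = x i := by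
  rw [mem_cylinder_iff_getElem?, length_initial]
  refine forall_congr' fun i => forall_congr' fun h => ?_
  rw [initial_getElem? x h, Option.some.injEq, eq_comm]

lemma mem_cylinder_initial (x : ℕ → α) (k : ℕ) : x ∈ cylinder (initial x k) :=
  mem_cylinder_initial_iff.2 fun _ _ => rfl

lemma cylinder_subset_of_prefix {u w : List α} (h : u <+: w) : cylinder w ⊆ cylinder u := by
  obtain ⟨t, rfl⟩ := h
  intro x hx i hi
  rw [hx i (by simp; omega), List.getElem_append_left hi]

/-- Two words with a common infinite extension are comparable. -/
lemma prefix_of_mem_cylinder {u w : List α} {x : ℕ → α} (hu : x ∈ cylinder u)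
    (hw : x ∈ cylinder w) (h : u.length ≤ w.length) : u <+: w := by
  rw [mem_cylinder_iff_initial] at hu hw
  rw [← hu, ← hw, List.prefix_iff_eq_take]
  simp [initial, ← List.map_take, List.take_range, h]

lemma initial_prefix_initial (x : ℕ → α) {j k : ℕ} (h : j ≤ k) : initial x j <+: initial x k :=
  prefix_of_mem_cylinder (mem_cylinder_initial x j) (mem_cylinder_initial x k) (by simpa using h)

lemma prefix_initial {u : List α} {x : ℕ → α} (hu : x ∈ cylinder u) {k : ℕ} (h : u.length ≤ k) :
    u <+: initial x k :=
  prefix_of_mem_cylinder hu (mem_cylinder_initial x k) (by simpa using h)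

/-- The word `w` followed by infinitely many copies of `d`. -/
def padded (d : α) (w : List α) : ℕ → α := fun n => w.getD n d

lemma padded_mem (d : α) (w : List α) : padded d w ∈ cylinder w := by
  intro i h
  simp [padded, h]

lemma cylinder_nonempty [Inhabited α] (w : List α) : (cylinder w).Nonempty :=
  ⟨_, padded_mem default w⟩

variable [TopologicalSpace α] [DiscreteTopology α]

lemma isOpen_cylinder (w : List α) : IsOpen (cylinder w) := by
  have : cylinder w = ⋂ i : Fin w.length, (fun x : ℕ → α => x i) ⁻¹' {w[i]} := by
    ext x
    simp only [Set.mem_iInter, Set.mem_preimage, Set.mem_singleton_iff]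
    exact ⟨fun h i => h i.1 i.2, fun h i hi => h ⟨i, hi⟩⟩
  rw [this]
  exact isOpen_iInter_of_finite fun i => (isOpen_discrete _).preimage (continuous_apply _)

lemma isOpen_basicOpen (o : Option (List α)) : IsOpen (basicOpen o) := by
  cases o with
  | none => exact isOpen_empty
  | some w => exact isOpen_cylinder w

lemma isOpen_iUnion_basicOpen (p : ℕ → Option (List α)) : IsOpen (⋃ n, basicOpen (p n)) :=
  isOpen_iUnion fun n => isOpen_basicOpen (p n)

lemma exists_cylinder_subset {U : Set (ℕ → α)} (hU : IsOpen U) {x : ℕ → α} (hx : x ∈ U) :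
    ∃ k, cylinder (initial x k) ⊆ U := by
  obtain ⟨_, ⟨y, k, rfl⟩, hxk, hk⟩ :=
    (PiNat.isTopologicalBasis_cylinders (fun _ : ℕ => α)).exists_subset_of_mem_open hx hU
  refine ⟨k, fun z hz => hk ?_⟩
  rw [mem_cylinder_initial_iff] at hz
  exact fun i hi => (hz i hi).trans (hxk i hi)

lemma mem_closure_iff_initial {S : Set (ℕ → α)} {x : ℕ → α} :
    x ∈ closure S ↔ ∀ k, (cylinder (initial x k) ∩ S).Nonempty := by
  rw [mem_closure_iff]
  constructor
  · exact fun h k => h _ (isOpen_cylinder _) (mem_cylinder_initial x k)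
  · intro h U hU hx
    obtain ⟨k, hk⟩ := exists_cylinder_subset hU hx
    exact (h k).mono (Set.inter_subset_inter_left _ hk)

lemma dense_iff_cylinder [Inhabited α] {S : Set (ℕ → α)} :
    Dense S ↔ ∀ w, (cylinder w ∩ S).Nonempty := by
  constructor
  · exact fun h w => h.inter_open_nonempty _ (isOpen_cylinder w) (cylinder_nonempty w)
  · exact fun h x => mem_closure_iff_initial.2 fun k => h _

lemma isClosed_negClosed (p : ℕ → Option (List α)) : IsClosed (negClosed p) :=
  (isOpen_iUnion_basicOpen p).isClosed_compl

lemma dense_iUnion_basicOpen {p : ℕ → Option (List α)} (h : IsNowhereDense (negClosed p)) :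
    Dense (⋃ n, basicOpen (p n)) := by
  have := (isClosed_isNowhereDense_iff_compl.1 ⟨isClosed_negClosed p, h⟩).2
  rwa [negClosed, compl_compl] at this

/-- A point lies on the boundary of an open set exactly if no prefix of it decides the set. -/
lemma notMem_frontier_iff {U : Set (ℕ → α)} (hU : IsOpen U) {x : ℕ → α} :
    x ∉ frontier U ↔ ∃ w, x ∈ cylinder w ∧ (cylinder w ⊆ U ∨ cylinder w ∩ U = ∅) := by
  rw [hU.frontier_eq, Set.mem_sdiff, not_and_not_right]
  constructor
  · intro h
    by_cases hx : x ∈ U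
    · obtain ⟨k, hk⟩ := exists_cylinder_subset hU hx
      exact ⟨_, mem_cylinder_initial x k, Or.inl hk⟩
    · have := mt h hx
      rw [mem_closure_iff_initial] at this
      push Not at this
      obtain ⟨k, hk⟩ := this
      exact ⟨_, mem_cylinder_initial x k, Or.inr hk⟩
  · rintro ⟨w, hx, h | h⟩ hc
    · exact h hx
    · obtain ⟨y, hy⟩ := mem_closure_iff.1 hc _ (isOpen_cylinder w) hx
      rw [h] at hy
      exact hy.elim

end Words

/-! ### Computability of searches in words -/

lemma primrecRel_prefix : PrimrecRel (fun u w : List Bool => u <+: w) := by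
  have : PrimrecRel (fun u w : List Bool => u = w.take u.length) :=
    (Primrec.eq (α := List Bool)).comp Primrec.fst
      (Primrec.list_take.comp (Primrec.list_length.comp Primrec.fst) Primrec.snd)
  exact this.of_eq fun u w => List.prefix_iff_eq_take.symm

/-- The Boolean version of the prefix relation for a code of a basic open set: `true` if the
cylinder of `w` is visibly contained in the basic open set `o`. -/
def covers (o : Option (List Bool)) (w : List Bool) : Bool :=
  o.elim false fun u => decide (u <+: w)

lemma computable_decide_prefix : Computable₂ (fun u w : List Bool => decide (u <+: w)) :=
  (primrecRel_prefix.decide).to_comp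

lemma computable_covers : Computable₂ covers := by
  refine (Computable.option_casesOn (o := fun a : Option (List Bool) × List Bool => a.1)
    (f := fun _ => false) (g := fun a u => decide (u <+: a.2)) Computable.fst
    (Computable.const _) ?_).of_eq ?_
  · exact computable_decide_prefix.comp Computable.snd (Computable.snd.comp Computable.fst)
  · rintro ⟨_ | u, w⟩ <;> rfl

lemma covers_iff {o : Option (List Bool)} {w : List Bool} :
    covers o w = true ↔ ∃ u, o = some u ∧ u <+: w := by
  cases o <;> simp [covers]

lemma covers_mono {o : Option (List Bool)} {u w : List Bool} (h : u <+: w)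
    (hc : covers o u = true) : covers o w = true := by
  rw [covers_iff] at *
  obtain ⟨v, hv, hvu⟩ := hc
  exact ⟨v, hv, hvu.trans h⟩

lemma cylinder_subset_of_covers {o : Option (List Bool)} {w : List Bool}
    (hc : covers o w = true) : cylinder w ⊆ basicOpen o := by
  obtain ⟨u, rfl, h⟩ := covers_iff.1 hc
  exact cylinder_subset_of_prefix h

/-- The intersection of a basic open set with a cylinder: if it is nonempty, then it is a cylinder
again, and its word is returned. -/
def meet (o : Option (List Bool)) (w : List Bool) : Option (List Bool) :=
  o.bind fun u => bif decide (u <+: w) then some w else bif decide (w <+: u) then some u else none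

lemma computable_meet : Computable₂ meet := by
  refine Computable.option_bind (f := fun a : Option (List Bool) × List Bool => a.1)
    (g := fun a u => bif decide (u <+: a.2) then some a.2 else
      bif decide (a.2 <+: u) then some u else none) Computable.fst ?_
  have hw : Computable (fun b : (Option (List Bool) × List Bool) × List Bool => b.1.2) :=
    Computable.snd.comp Computable.fst
  have hu : Computable (fun b : (Option (List Bool) × List Bool) × List Bool => b.2) :=
    Computable.snd
  exact Computable.cond (computable_decide_prefix.comp hu hw) (Computable.option_some.comp hw)
    (Computable.cond (computable_decide_prefix.comp hw hu) (Computable.option_some.comp hu)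
      (Computable.const _))

lemma meet_eq_some {o : Option (List Bool)} {w v : List Bool} (h : meet o w = some v) :
    w <+: v ∧ cylinder v ⊆ basicOpen o := by
  rcases o with _ | u
  · simp [meet] at h
  by_cases h1 : u <+: w
  · simp only [meet, Option.bind_some, h1, decide_true, cond_true, Option.some.injEq] at h
    subst h
    exact ⟨List.prefix_rfl, cylinder_subset_of_prefix h1⟩
  · by_cases h2 : w <+: u
    · simp only [meet, Option.bind_some, h1, h2, decide_true, decide_false, cond_true, cond_false,
        Option.some.injEq] at h
      subst h
      exact ⟨h2, subset_rfl⟩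
    · simp [meet, h1, h2] at h

lemma meet_isSome_iff {o : Option (List Bool)} {w : List Bool} :
    (meet o w).isSome = true ↔ (cylinder w ∩ basicOpen o).Nonempty := by
  constructor
  · intro h
    obtain ⟨v, hv⟩ := Option.isSome_iff_exists.1 h
    obtain ⟨h1, h2⟩ := meet_eq_some hv
    obtain ⟨x, hx⟩ := cylinder_nonempty v
    exact ⟨x, cylinder_subset_of_prefix h1 hx, h2 hx⟩
  · rcases o with _ | u
    · rintro ⟨x, _, hx⟩
      exact hx.elim
    · rintro ⟨x, hw, hu⟩
      rcases le_total u.length w.length with hl | hl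
      · simp [meet, prefix_of_mem_cylinder hu hw hl]
      · by_cases h1 : u <+: w <;> simp [meet, h1, prefix_of_mem_cylinder hw hu hl]

lemma computable_any {α : Type} [Primcodable α] {f : α → ℕ → Bool} (hf : Computable₂ f)
    {k : α → ℕ} (hk : Computable k) : Computable fun a => (List.range (k a)).any (f a) := by
  refine (Computable.nat_rec (f := k) (g := fun _ => false)
    (h := fun a b => b.2 || f a b.1) hk (Computable.const _) ?_).of_eq ?_
  · have h2 : Computable fun b : α × ℕ × Bool => f b.1 b.2.1 :=
      hf.comp Computable.fst (Computable.fst.comp Computable.snd)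
    exact (Primrec.or.to_comp).comp (Computable.snd.comp Computable.snd) h2
  · intro a
    induction k a with
    | zero => rfl
    | succ n ih => simp [List.range_succ, ← ih]

/-- The first value among `f 0, …, f (k - 1)` that is not `none`. -/
def firstSome {β : Type} (f : ℕ → Option β) (k : ℕ) : Option β :=
  Nat.rec none (fun n o => o.elim (f n) some) k

lemma computable_firstSome {α β : Type} [Primcodable α] [Primcodable β] {f : α → ℕ → Option β}
    (hf : Computable₂ f) {k : α → ℕ} (hk : Computable k) :
    Computable fun a => firstSome (f a) (k a) := by
  refine Computable.nat_rec (f := k) (g := fun _ => none)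
    (h := fun a b => b.2.elim (f a b.1) some) hk (Computable.const _) ?_
  have h2 : Computable fun b : α × ℕ × Option β => f b.1 b.2.1 :=
    hf.comp Computable.fst (Computable.fst.comp Computable.snd)
  refine (Computable.option_casesOn (Computable.snd.comp Computable.snd) h2
    (Computable.option_some.comp Computable.snd).to₂).of_eq ?_
  rintro ⟨a, n, _ | b⟩ <;> rfl

lemma firstSome_eq_some {β : Type} {f : ℕ → Option β} {k n : ℕ} {b : β} (hk : n < k)
    (hb : f n = some b) (hlt : ∀ m < n, f m = none) : firstSome f k = some b := by
  have h0 : ∀ m ≤ n, firstSome f m = none := by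
    intro m
    induction m with
    | zero => exact fun _ => rfl
    | succ m ih =>
      intro hm
      change (firstSome f m).elim (f m) some = none
      rw [ih (by omega)]
      exact hlt m (by omega)
  induction k with
  | zero => omega
  | succ k ih =>
    change (firstSome f k).elim (f k) some = some b
    rcases Nat.lt_succ_iff_lt_or_eq.1 hk with h | rfl
    · rw [ih h]
      rfl
    · rw [h0 n le_rfl]
      exact hb

/-- The sequence that runs through `f` and `g` alternately. -/
def interleave {β : Type} (f g : ℕ → β) (n : ℕ) : β := bif n.bodd then f n.div2 else g n.div2

lemma exists_interleave {β : Type} (f g : ℕ → β) (P : β → Prop) :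
    (∃ n, P (interleave f g n)) ↔ (∃ n, P (f n)) ∨ ∃ n, P (g n) := by
  constructor
  · rintro ⟨n, hn⟩
    cases h : n.bodd
    · exact Or.inr ⟨n.div2, by simpa [interleave, h] using hn⟩
    · exact Or.inl ⟨n.div2, by simpa [interleave, h] using hn⟩
  · rintro (⟨n, hn⟩ | ⟨n, hn⟩)
    · refine ⟨Nat.bit true n, ?_⟩
      rwa [interleave, Nat.bodd_bit, Nat.div2_bit]
    · refine ⟨Nat.bit false n, ?_⟩
      rwa [interleave, Nat.bodd_bit, Nat.div2_bit]

lemma forall_interleave {β : Type} (f g : ℕ → β) (P : β → Prop) :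
    (∀ n, P (interleave f g n)) ↔ (∀ n, P (f n)) ∧ ∀ n, P (g n) := by
  have := exists_interleave f g fun b => ¬ P b
  exact not_iff_not.1 (by simpa only [not_and_or, not_forall] using this)

lemma iUnion_interleave {β γ : Type} (f g : ℕ → β) (F : β → Set γ) :
    ⋃ n, F (interleave f g n) = (⋃ n, F (f n)) ∪ ⋃ n, F (g n) := by
  ext x
  simp only [Set.mem_iUnion, Set.mem_union]
  exact exists_interleave f g fun b => x ∈ F b

lemma computable_interleave {α β : Type} [Primcodable α] [Primcodable β] {f g : α → ℕ → β}
    (hf : Computable₂ f) (hg : Computable₂ g) {n : α → ℕ} (hn : Computable n) :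
    Computable fun a => interleave (f a) (g a) (n a) :=
  Computable.cond (Computable.nat_bodd.comp hn)
    (hf.comp Computable.id (Computable.nat_div2.comp hn))
    (hg.comp Computable.id (Computable.nat_div2.comp hn))

/-! ### Formal properties of the three notions of comeagerness -/

lemma compl_inter_interleave {α : Type} {A B : Set (ℕ → α)} {S T : ℕ → Set (ℕ → α)}
    (hA : Aᶜ = ⋃ i, S i) (hB : Bᶜ = ⋃ i, T i) : (A ∩ B)ᶜ = ⋃ i, interleave S T i := by
  rw [Set.compl_inter, hA, hB]
  exact (iUnion_interleave S T id).symm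

lemma cylinder_nil {α : Type} : cylinder ([] : List α) = Set.univ :=
  Set.eq_univ_of_forall fun _ _ h => absurd h (Nat.not_lt_zero _)

section Univ

variable {α : Type} [Primcodable α] [TopologicalSpace α]

lemma ceComeager_univ : CEComeager (Set.univ : Set (ℕ → α)) :=
  ⟨fun _ => ∅, ⟨fun _ _ => some [], Computable.const _, fun _ => by
    simp [negClosed, basicOpen, cylinder_nil, Set.iUnion_const]⟩,
    fun _ => isNowhereDense_empty, by simp⟩

lemma coCEComeager_univ [Inhabited α] : CoCEComeager (Set.univ : Set (ℕ → α)) :=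
  ⟨fun _ => ∅, ⟨fun _ _ => false, fun _ _ _ => default, Computable.const _, Computable.const _,
    fun _ => by simp [posClosed]⟩, fun _ => isNowhereDense_empty, by simp⟩

lemma CEComeager.inLimit {A : Set (ℕ → α)} (h : CEComeager A) : CEComeagerInLimit A := by
  obtain ⟨S, ⟨p, hp, hS⟩, hn, hA⟩ := h
  exact ⟨S, ⟨fun i _ n => p i n, p,
    hp.comp (Computable.pair Computable.fst (Computable.snd.comp Computable.snd)),
    fun _ _ => Eventually.of_forall fun _ => rfl, hS⟩, hn, hA⟩

lemma interleave_forall₂ {β γ : Type} {f g : ℕ → β} {f' g' : ℕ → γ} {R : β → γ → Prop}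
    (h : ∀ n, R (f n) (f' n)) (h' : ∀ n, R (g n) (g' n)) (n : ℕ) :
    R (interleave f g n) (interleave f' g' n) := by
  unfold interleave
  cases n.bodd
  · exact h' _
  · exact h _

lemma interleave_apply {β γ : Type} (f g : ℕ → β → γ) (n : ℕ) (b : β) :
    interleave f g n b = interleave (fun n => f n b) (fun n => g n b) n := by
  unfold interleave
  cases n.bodd <;> rfl

/-- Interleaving two computable families of functions gives a computable family. -/
lemma computable_interleave_apply {β γ : Type} [Primcodable β] [Primcodable γ] {f g : ℕ → β → γ}
    (hf : Computable₂ f) (hg : Computable₂ g) : Computable₂ (interleave f g) := by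
  refine (computable_interleave (α := ℕ × β) (f := fun a n => f n a.2) (g := fun a n => g n a.2)
    (hf.comp Computable.snd (Computable.snd.comp Computable.fst))
    (hg.comp Computable.snd (Computable.snd.comp Computable.fst)) Computable.fst).of_eq ?_
  exact fun a => (interleave_apply f g a.1 a.2).symm

lemma CEComeager.inter {A B : Set (ℕ → α)} (hA : CEComeager A) (hB : CEComeager B) :
    CEComeager (A ∩ B) := by
  obtain ⟨S, ⟨p, hp, hS⟩, hn, hA⟩ := hA
  obtain ⟨T, ⟨q, hq, hT⟩, hm, hB⟩ := hB
  exact ⟨interleave S T, ⟨interleave p q, computable_interleave_apply hp hq,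
    interleave_forall₂ (R := fun s r => s = negClosed r) hS hT⟩,
    (forall_interleave S T IsNowhereDense).2 ⟨hn, hm⟩, compl_inter_interleave hA hB⟩

lemma CoCEComeager.inter {A B : Set (ℕ → α)} (hA : CoCEComeager A) (hB : CoCEComeager B) :
    CoCEComeager (A ∩ B) := by
  obtain ⟨S, ⟨d, x, hd, hx, hS⟩, hn, hA⟩ := hA
  obtain ⟨T, ⟨e, y, he, hy, hT⟩, hm, hB⟩ := hB
  refine ⟨interleave S T, ⟨interleave d e, interleave x y,
    computable_interleave_apply hd he, ?_, fun i => ?_⟩,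
    (forall_interleave S T IsNowhereDense).2 ⟨hn, hm⟩, compl_inter_interleave hA hB⟩
  · refine (computable_interleave_apply (β := ℕ × ℕ) (f := fun i a => x i a.1 a.2)
      (g := fun i a => y i a.1 a.2) hx hy).of_eq ?_
    rintro ⟨i, n, j⟩
    unfold interleave
    dsimp only
    cases i.bodd <;> rfl
  · unfold interleave
    cases i.bodd
    · exact hT _
    · exact hS _

lemma CEComeagerInLimit.inter {A B : Set (ℕ → α)} (hA : CEComeagerInLimit A)
    (hB : CEComeagerInLimit B) : CEComeagerInLimit (A ∩ B) := by
  obtain ⟨S, ⟨p, r, hp, hpr, hS⟩, hn, hA⟩ := hA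
  obtain ⟨T, ⟨q, s, hq, hqs, hT⟩, hm, hB⟩ := hB
  refine ⟨interleave S T, ⟨interleave p q, interleave r s, ?_,
    interleave_forall₂ (R := fun (f : ℕ → ℕ → Option (List α)) (g : ℕ → Option (List α)) =>
      ∀ n, ∀ᶠ k in atTop, f k n = g n) hpr hqs,
    interleave_forall₂ (R := fun s r => s = negClosed r) hS hT⟩,
    (forall_interleave S T IsNowhereDense).2 ⟨hn, hm⟩, compl_inter_interleave hA hB⟩
  refine (computable_interleave_apply (β := ℕ × ℕ) (f := fun i a => p i a.1 a.2)
    (g := fun i a => q i a.1 a.2) hp hq).of_eq ?_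
  rintro ⟨i, n, j⟩
  unfold interleave
  dsimp only
  cases i.bodd <;> rfl

end Univ

/-- The word with code `n`; a default word if `n` is not a code. -/
def wordOf (n : ℕ) : List Bool := (Encodable.decode n).getD []

lemma computable_wordOf : Computable wordOf :=
  Computable.option_getD Computable.decode (Computable.const _)

lemma wordOf_encode (w : List Bool) : wordOf (Encodable.encode w) = w := by
  simp [wordOf]

lemma computable_initial {α : Type} [Primcodable α] {x : α → ℕ → Bool} (hx : Computable₂ x)
    {k : α → ℕ} (hk : Computable k) : Computable fun a => initial (x a) (k a) := by
  refine (Computable.nat_rec (f := k) (g := fun _ => []) (h := fun a b => b.2 ++ [x a b.1]) hk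
    (Computable.const _) ?_).of_eq ?_
  · exact Computable.list_concat.comp (Computable.snd.comp Computable.snd)
      (hx.comp Computable.fst (Computable.fst.comp Computable.snd))
  · intro a
    induction k a with
    | zero => rfl
    | succ n ih => simp [initial, List.range_succ, ih]

lemma computable_mem_cylinder {α : Type} [Primcodable α] {x : α → ℕ → Bool}
    (hx : Computable₂ x) {w : α → List Bool} (hw : Computable w) :
    Computable fun a => decide (initial (x a) (w a).length = w a) :=
  ((Primrec.eq (α := List Bool)).decide.to_comp).comp
    (computable_initial hx (Computable.list_length.comp hw)) hw

/-- A value that is withdrawn as soon as the search for some `m` with `f m = true` succeeds converges,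
since it changes at most once. -/
lemma eventually_withdraw {β : Type} (w : Option β) (f : ℕ → Bool) [Decidable (∃ m, f m = true)] :
    ∀ᶠ k in atTop, (bif (List.range k).any f then none else w) =
      if ∃ m, f m = true then none else w := by
  split_ifs with h
  · obtain ⟨m, hm⟩ := h
    filter_upwards [eventually_gt_atTop m] with k hk
    rw [(List.any_eq_true.2 ⟨m, List.mem_range.2 hk, hm⟩ : (List.range k).any f = true)]
    rfl
  · refine Eventually.of_forall fun k => ?_
    have : (List.range k).any f = false := by
      rw [List.any_eq_false]
      exact fun m _ hm => h ⟨m, hm⟩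
    rw [this]
    rfl

/-- The complement of the closure of a computable sequence of points consists of the cylinders that
no point of the sequence ever enters, and it takes one limit to find these. -/
lemma CoCEComeager.inLimit {A : Set (ℕ → Bool)} (h : CoCEComeager A) : CEComeagerInLimit A := by
  classical
  obtain ⟨S, ⟨d, x, hd, hx, hS⟩, hn, hA⟩ := h
  set f : ℕ → ℕ → ℕ → Bool := fun i n m =>
    d i m && decide (initial (x i m) (wordOf n).length = wordOf n) with hf
  refine ⟨S, ⟨fun i k n => bif (List.range k).any (f i n) then none else some (wordOf n),
    fun i n => if ∃ m, f i n m = true then none else some (wordOf n), ?_,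
    fun i n => eventually_withdraw _ _, fun i => ?_⟩, hn, hA⟩
  · have hw : Computable fun t : ℕ × ℕ × ℕ => wordOf t.2.2 :=
      computable_wordOf.comp (Computable.snd.comp Computable.snd)
    refine Computable.cond (computable_any (f := fun t : ℕ × ℕ × ℕ => f t.1 t.2.2) ?_
      (Computable.fst.comp Computable.snd)) (Computable.const _) (Computable.option_some.comp hw)
    have h1 : Computable fun s : (ℕ × ℕ × ℕ) × ℕ => d s.1.1 s.2 :=
      (show Computable₂ d from hd).comp (Computable.fst.comp Computable.fst) Computable.snd
    have h0 : Computable fun s : ((ℕ × ℕ × ℕ) × ℕ) × ℕ => (s.1.1.1, s.1.2, s.2) :=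
      Computable.pair (Computable.fst.comp (Computable.fst.comp Computable.fst))
        (Computable.pair (Computable.snd.comp Computable.fst) Computable.snd)
    have h2 : Computable₂ fun (s : (ℕ × ℕ × ℕ) × ℕ) (j : ℕ) => x s.1.1 s.2 j := by
      have := hx.comp h0
      exact this
    exact (Primrec.and.to_comp).comp h1
      (computable_mem_cylinder h2 (hw.comp Computable.fst))
  · rw [hS i, negClosed, eq_compl_comm]
    ext y
    rw [Set.mem_compl_iff, posClosed, mem_closure_iff_initial, Set.mem_iUnion]
    push Not
    constructor
    · rintro ⟨n, hn⟩
      split_ifs at hn with h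
      · exact hn.elim
      · refine ⟨(wordOf n).length, ?_⟩
        rw [Set.eq_empty_iff_forall_notMem]
        rintro z ⟨hz, m, hm, rfl⟩
        rw [mem_cylinder_iff_initial.1 (show y ∈ cylinder (wordOf n) from hn)] at hz
        exact h ⟨m, by simp [hf, hm, mem_cylinder_iff_initial.1 hz]⟩
    · rintro ⟨k, hk⟩
      refine ⟨Encodable.encode (initial y k), ?_⟩
      rw [if_neg, wordOf_encode]
      · exact mem_cylinder_initial y k
      · rintro ⟨m, hm⟩
        simp only [hf, wordOf_encode, Bool.and_eq_true, decide_eq_true_eq] at hm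
        rw [Set.eq_empty_iff_forall_notMem] at hk
        exact hk _ ⟨mem_cylinder_iff_initial.2 hm.2, m, hm.1, rfl⟩

/-! ### Computably enumerable open sets and 1-generic points -/

/-- Computably enumerable open subsets of Cantor space. -/
def CEOpen (U : Set (ℕ → Bool)) : Prop :=
  ∃ f : ℕ → Option (List Bool), Computable f ∧ U = ⋃ n, basicOpen (f n)

/-- Computable oracles are of no help, so 1-genericity can be tested with plain c.e. open sets. -/
lemma oneGeneric_iff {p : ℕ → Bool} : OneGeneric p ↔ ∀ U : Set (ℕ → Bool), CEOpen U →
    ∃ w : List Bool, p ∈ cylinder w ∧ (cylinder w ⊆ U ∨ cylinder w ∩ U = ∅) := by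
  constructor
  · rintro ⟨q, -, h⟩ U ⟨f, hf, hU⟩
    exact h U ⟨f, hf.computableIn, hU⟩
  · intro h
    refine ⟨fun _ => false, Computable.const _, ?_⟩
    rintro U ⟨f, hf, hU⟩
    exact h U ⟨f, RecursiveIn.partrec_of_const hf, hU⟩

/-- A universal enumeration of the c.e. open sets: `ceName e` lists the words whose codes are values
of the partial recursive function with code `e`. -/
def ceName (e t : ℕ) : Option (List Bool) :=
  (Nat.Partrec.Code.evaln t.unpair.1 (Denumerable.ofNat Nat.Partrec.Code e) t.unpair.2).bind
    Encodable.decode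

/-- The `e`-th c.e. open set. -/
def ceOpen (e : ℕ) : Set (ℕ → Bool) := ⋃ t, basicOpen (ceName e t)

lemma computable_evaln : Computable fun a : (ℕ × ℕ) × ℕ =>
    Nat.Partrec.Code.evaln a.1.1 (Denumerable.ofNat Nat.Partrec.Code a.1.2) a.2 :=
  Nat.Partrec.Code.primrec_evaln.to_comp.comp (Computable.pair (Computable.pair
    (Computable.fst.comp Computable.fst)
    ((Computable.ofNat _).comp (Computable.snd.comp Computable.fst))) Computable.snd)

lemma computable_ceName : Computable₂ ceName := by
  refine Computable.option_bind (computable_evaln.comp (Computable.pair (Computable.pair ?_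
    Computable.fst) ?_)) (Computable.decode.comp Computable.snd)
  · exact Computable.fst.comp (Computable.unpair.comp Computable.snd)
  · exact Computable.snd.comp (Computable.unpair.comp Computable.snd)

lemma ceOpen_ceOpen (e : ℕ) : CEOpen (ceOpen e) :=
  ⟨ceName e, computable_ceName.comp (Computable.const e) Computable.id, rfl⟩

lemma isOpen_ceOpen (e : ℕ) : IsOpen (ceOpen e) := isOpen_iUnion_basicOpen _

/-- The cylinders listed by a partial recursive function form a c.e. open set. -/
lemma exists_ceOpen_eq_of_partrec {β : Type} [Primcodable β] {F : β →. List Bool}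
    (hF : Partrec F) : ∃ e, ceOpen e = {x | ∃ b, ∃ w ∈ F b, x ∈ cylinder w} := by
  obtain ⟨c, hc⟩ := Nat.Partrec.Code.exists_code.1 hF
  refine ⟨Encodable.encode c, ?_⟩
  ext x
  rw [ceOpen, Set.mem_iUnion]
  constructor
  · rintro ⟨t, ht⟩
    cases hv : Nat.Partrec.Code.evaln t.unpair.1 c t.unpair.2 with
    | none => simp [ceName, hv, basicOpen] at ht
    | some v =>
      have := Nat.Partrec.Code.evaln_sound hv
      rw [hc] at this
      obtain ⟨b, hb, hv'⟩ := Part.mem_bind_iff.1 this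
      obtain ⟨w, hw, rfl⟩ := (Part.mem_map_iff _).1 hv'
      refine ⟨b, w, hw, ?_⟩
      simpa [ceName, hv, basicOpen] using ht
  · rintro ⟨b, w, hw, hx⟩
    have : Encodable.encode w ∈ c.eval (Encodable.encode b) := by
      rw [hc]
      refine Part.mem_bind_iff.2 ⟨b, ?_, (Part.mem_map_iff _).2 ⟨w, hw, rfl⟩⟩
      simp
    obtain ⟨k, hk⟩ := Nat.Partrec.Code.evaln_complete.1 this
    refine ⟨Nat.pair k (Encodable.encode b), ?_⟩
    rw [Option.mem_def] at hk
    simpa [ceName, hk, basicOpen] using hx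

lemma CEOpen.exists_eq {U : Set (ℕ → Bool)} (hU : CEOpen U) : ∃ e, ceOpen e = U := by
  obtain ⟨f, hf, rfl⟩ := hU
  obtain ⟨e, he⟩ := exists_ceOpen_eq_of_partrec hf.ofOption
  refine ⟨e, he.trans ?_⟩
  ext x
  rw [Set.mem_ofPred_eq, Set.mem_iUnion]
  refine exists_congr fun n => ?_
  cases f n <;> simp [basicOpen]

lemma ceOpen_of_partrec {β : Type} [Primcodable β] {F : β →. List Bool}
    (hF : Partrec F) : CEOpen {x | ∃ b, ∃ w ∈ F b, x ∈ cylinder w} := by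
  obtain ⟨e, he⟩ := exists_ceOpen_eq_of_partrec hF
  exact he ▸ ceOpen_ceOpen e

/-- A point is 1-generic if and only if it lies on the boundary of no c.e. open set. -/
lemma oneGeneric_iff_frontier {p : ℕ → Bool} :
    OneGeneric p ↔ ∀ e, p ∉ frontier (ceOpen e) := by
  rw [oneGeneric_iff]
  constructor
  · exact fun h e => (notMem_frontier_iff (isOpen_ceOpen e)).2 (h _ (ceOpen_ceOpen e))
  · intro h U hU
    obtain ⟨e, rfl⟩ := hU.exists_eq
    exact (notMem_frontier_iff (isOpen_ceOpen e)).1 (h e)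

lemma computable_disjoint : Computable₂ (fun (o : Option (List Bool)) (w : List Bool) =>
    (meet o w).isSome) :=
  (Primrec.option_isSome.to_comp).comp computable_meet

/-- The complement of the boundary of a c.e. open set `U` is the union of `U` and of the cylinders
disjoint from `U`; the latter can be found in the limit. -/
lemma ceComeagerInLimit_oneGeneric : CEComeagerInLimit {p : ℕ → Bool | OneGeneric p} := by
  classical
  set f : ℕ → ℕ → ℕ → Bool := fun e n m => (meet (ceName e m) (wordOf n)).isSome with hf
  refine ⟨fun e => frontier (ceOpen e), ⟨fun e k => interleave (ceName e)
      (fun n => bif (List.range k).any (f e n) then none else some (wordOf n)),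
    fun e => interleave (ceName e)
      (fun n => if ∃ m, f e n m = true then none else some (wordOf n)), ?_, fun e n => ?_,
    fun e => ?_⟩, fun e => isNowhereDense_frontier (isOpen_ceOpen e), ?_⟩
  · refine computable_interleave (α := ℕ × ℕ × ℕ) (f := fun t => ceName t.1)
      (g := fun t n => bif (List.range t.2.1).any (f t.1 n) then none else some (wordOf n))
      (computable_ceName.comp (Computable.fst.comp Computable.fst) Computable.snd) ?_
      (Computable.snd.comp Computable.snd)
    have hw : Computable fun t : (ℕ × ℕ × ℕ) × ℕ => wordOf t.2 :=
      computable_wordOf.comp Computable.snd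
    refine Computable.cond (computable_any (f := fun t : (ℕ × ℕ × ℕ) × ℕ => f t.1.1 t.2) ?_
      (Computable.fst.comp (Computable.snd.comp Computable.fst))) (Computable.const _)
      (Computable.option_some.comp hw)
    exact computable_disjoint.comp (computable_ceName.comp (Computable.fst.comp
      (Computable.fst.comp Computable.fst)) Computable.snd) (hw.comp Computable.fst)
  · unfold interleave
    dsimp only
    cases n.bodd
    · exact eventually_withdraw (some (wordOf n.div2)) (f e n.div2)
    · exact Eventually.of_forall fun _ => rfl
  · rw [negClosed, eq_compl_comm]
    ext x
    rw [Set.mem_compl_iff, notMem_frontier_iff (isOpen_ceOpen e), iUnion_interleave, Set.mem_union]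
    constructor
    · rintro (h | h)
      · obtain ⟨k, hk⟩ := exists_cylinder_subset (isOpen_ceOpen e) h
        exact ⟨_, mem_cylinder_initial x k, Or.inl hk⟩
      · obtain ⟨n, hn⟩ := Set.mem_iUnion.1 h
        split_ifs at hn with hm
        · exact hn.elim
        · refine ⟨wordOf n, hn, Or.inr ?_⟩
          rw [Set.eq_empty_iff_forall_notMem]
          rintro y ⟨hy, hy'⟩
          obtain ⟨m, hym⟩ := Set.mem_iUnion.1 hy'
          exact hm ⟨m, meet_isSome_iff.2 ⟨y, hy, hym⟩⟩
    · rintro ⟨w, hx, h | h⟩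
      · exact Or.inl (h hx)
      · refine Or.inr (Set.mem_iUnion.2 ⟨Encodable.encode w, ?_⟩)
        rw [if_neg, wordOf_encode]
        · exact hx
        · rintro ⟨m, hm⟩
          simp only [hf, wordOf_encode] at hm
          obtain ⟨y, hy, hy'⟩ := meet_isSome_iff.1 hm
          exact Set.eq_empty_iff_forall_notMem.1 h y ⟨hy, Set.mem_iUnion.2 ⟨m, hy'⟩⟩
  · ext p
    simp [oneGeneric_iff_frontier]

/-! ### Effective versions of the Baire category theorem -/

/-- The words obtained from `w` by applying the extension functions `E 0, E 1, …` in turn. -/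
def chain (E : ℕ → List Bool → List Bool) (w : List Bool) (i : ℕ) : List Bool :=
  Nat.rec w (fun j v => E j v) i

/-- The point of Cantor space that extends all words of a chain. -/
def chainPoint (E : ℕ → List Bool → List Bool) (w : List Bool) (n : ℕ) : Bool :=
  (chain E w (n + 1)).getD n false

lemma chain_prefix {E : ℕ → List Bool → List Bool}
    (hE : ∀ i v, v ++ [false] <+: E i v) (w : List Bool) {i j : ℕ} (h : i ≤ j) :
    chain E w i <+: chain E w j := by
  induction h with
  | refl => exact List.prefix_rfl
  | step _ ih => exact ih.trans ((List.prefix_append _ _).trans (hE _ _))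

lemma le_length_chain {E : ℕ → List Bool → List Bool}
    (hE : ∀ i v, v ++ [false] <+: E i v) (w : List Bool) (i : ℕ) : i ≤ (chain E w i).length := by
  induction i with
  | zero => exact Nat.zero_le _
  | succ i ih =>
    have := (hE i (chain E w i)).length_le
    rw [List.length_append, List.length_singleton] at this
    exact (Nat.succ_le_succ ih).trans this

lemma chainPoint_mem {E : ℕ → List Bool → List Bool}
    (hE : ∀ i v, v ++ [false] <+: E i v) (w : List Bool) (i : ℕ) :
    chainPoint E w ∈ cylinder (chain E w i) := by
  rw [mem_cylinder_iff_getElem?]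
  intro n hn
  have hn' : n < (chain E w (n + 1)).length := le_length_chain hE w (n + 1)
  have key : (chain E w (n + 1))[n]? = some (chainPoint E w n) := by
    rw [chainPoint, List.getD_eq_getElem?_getD, List.getElem?_eq_getElem hn']
    rfl
  rw [← key]
  rcases le_total i (n + 1) with h | h
  · exact (List.prefix_iff_getElem?.1 (chain_prefix hE w h) n hn).symm ▸
      List.getElem?_eq_getElem hn
  · rw [List.prefix_iff_getElem?.1 (chain_prefix hE w h) n hn',
      List.getElem?_eq_getElem hn']

lemma computable_chainPoint {E : ℕ → ℕ → List Bool → List Bool}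
    (hE : Computable fun b : (ℕ × ℕ) × List Bool => E b.1.1 b.1.2 b.2) (w : List Bool) :
    Computable fun t : ℕ × ℕ => chainPoint (E t.1) w t.2 := by
  have h0 : Computable fun s : (ℕ × ℕ) × ℕ × List Bool => ((s.1.1, s.2.1), s.2.2) :=
    Computable.pair (Computable.pair (Computable.fst.comp Computable.fst)
      (Computable.fst.comp Computable.snd)) (Computable.snd.comp Computable.snd)
  have h1 : Computable₂ fun (t : ℕ × ℕ) (s : ℕ × List Bool) => E t.1 s.1 s.2 := by
    have := hE.comp h0
    exact this
  have h2 : Computable fun t : ℕ × ℕ => chain (E t.1) w (t.2 + 1) :=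
    Computable.nat_rec (Computable.succ.comp Computable.snd) (Computable.const w) h1
  exact ((Primrec.list_getD false).to_comp).comp h2 Computable.snd

lemma chainPoint_notMem_negClosed {E : ℕ → List Bool → List Bool} {p : ℕ → ℕ → Option (List Bool)}
    (hE : ∀ i v, v ++ [false] <+: E i v)
    (hp : ∀ i v, cylinder (E i v) ⊆ ⋃ n, basicOpen (p i n)) (w : List Bool) (i : ℕ) :
    chainPoint E w ∉ negClosed (p i) := by
  rw [negClosed, Set.notMem_compl_iff]
  exact hp i (chain E w i) (chainPoint_mem hE w (i + 1))

lemma exists_meet {p : ℕ → Option (List Bool)} (h : IsNowhereDense (negClosed p))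
    (w : List Bool) : ∃ n, (meet (p n) w).isSome = true := by
  obtain ⟨x, hx, hx'⟩ := dense_iff_cylinder.1 (dense_iUnion_basicOpen h) w
  obtain ⟨n, hn⟩ := Set.mem_iUnion.1 hx'
  exact ⟨n, meet_isSome_iff.2 ⟨x, hx, hn⟩⟩

/-- The extensions required by the Baire category theorem are found by unbounded search. -/
lemma CEComeager.exists_computable {A : Set (ℕ → Bool)} (h : CEComeager A) (w : List Bool) :
    ∃ x ∈ cylinder w, x ∈ A ∧ Computable x := by
  obtain ⟨S, ⟨p, hp, hS⟩, hn, hA⟩ := h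
  set F : ℕ × List Bool →. List Bool :=
    fun a => Nat.rfindOpt fun n => meet (p a.1 n) (a.2 ++ [false]) with hF
  have hdom : ∀ a, (F a).Dom := by
    intro a
    obtain ⟨n, hn⟩ := exists_meet (hS a.1 ▸ hn a.1) (a.2 ++ [false])
    obtain ⟨v, hv⟩ := Option.isSome_iff_exists.1 hn
    exact Nat.rfindOpt_dom.2 ⟨n, v, hv⟩
  have hspec : ∀ a, a.2 ++ [false] <+: (F a).get (hdom a) ∧
      cylinder ((F a).get (hdom a)) ⊆ ⋃ n, basicOpen (p a.1 n) := by
    intro a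
    obtain ⟨n, hn⟩ := Nat.rfindOpt_spec (Part.get_mem (hdom a))
    obtain ⟨h1, h2⟩ := meet_eq_some hn
    exact ⟨h1, h2.trans (Set.subset_iUnion_of_subset n subset_rfl)⟩
  have hc : Computable fun a => (F a).get (hdom a) := by
    refine Partrec.of_eq_tot (f := F) ?_ fun a => Part.get_mem (hdom a)
    have h1 : Computable fun s : (ℕ × List Bool) × ℕ => p s.1.1 s.2 :=
      (show Computable₂ p from hp).comp (Computable.fst.comp Computable.fst) Computable.snd
    have h2 : Computable fun s : (ℕ × List Bool) × ℕ => s.1.2 ++ [false] :=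
      Computable.list_concat.comp (Computable.snd.comp Computable.fst) (Computable.const false)
    have h3 : Computable₂ fun (a : ℕ × List Bool) n => meet (p a.1 n) (a.2 ++ [false]) := by
      have := computable_meet.comp h1 h2
      exact this
    exact Partrec.rfindOpt h3
  set E : ℕ → List Bool → List Bool := fun i v => (F (i, v)).get (hdom (i, v)) with hEdef
  refine ⟨chainPoint E w, chainPoint_mem (fun i v => (hspec (i, v)).1) w 0, ?_, ?_⟩
  · rw [← Set.notMem_compl_iff, hA, Set.mem_iUnion]
    rintro ⟨i, hi⟩
    rw [hS i] at hi
    exact chainPoint_notMem_negClosed (fun i v => (hspec (i, v)).1)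
      (fun i v => (hspec (i, v)).2) w i hi
  · have h0 : Computable fun b : (ℕ × ℕ) × List Bool => (b.1.2, b.2) :=
      Computable.pair (Computable.snd.comp Computable.fst) Computable.snd
    have h1 : Computable fun b : (ℕ × ℕ) × List Bool => E b.1.2 b.2 := hc.comp h0
    have h2 : Computable₂ fun (_ : ℕ) n => chainPoint E w n :=
      computable_chainPoint (E := fun _ => E) h1 w
    exact h2.comp (Computable.const 0) Computable.id

/-- At stage `k` the required extensions are sought among the first `k` approximations to the basic
open sets, and a default extension is used if none is found. Each of the extensions converges. -/
lemma CEComeagerInLimit.exists_limitComputable {A : Set (ℕ → Bool)} (h : CEComeagerInLimit A)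
    (w : List Bool) : ∃ x ∈ cylinder w, x ∈ A ∧ LimitComputable x := by
  obtain ⟨S, ⟨p, r, hp, hpr, hS⟩, hn, hA⟩ := h
  set E : ℕ → ℕ → List Bool → List Bool := fun k i v =>
    (firstSome (fun n => meet (p i k n) (v ++ [false])) k).getD (v ++ [false]) with hEdef
  have hlim : ∀ i v, ∃ u, v ++ [false] <+: u ∧ cylinder u ⊆ ⋃ n, basicOpen (r i n) ∧
      ∀ᶠ k in atTop, E k i v = u := by
    intro i v
    have hex := exists_meet (hS i ▸ hn i) (v ++ [false])
    obtain ⟨u, hu⟩ := Option.isSome_iff_exists.1 (Nat.find_spec hex)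
    obtain ⟨h1, h2⟩ := meet_eq_some hu
    refine ⟨u, h1, h2.trans (Set.subset_iUnion_of_subset _ subset_rfl), ?_⟩
    have hev : ∀ᶠ k in atTop, ∀ n ≤ Nat.find hex, p i k n = r i n :=
      (Set.finite_Iic (Nat.find hex)).eventually_all.2 fun n _ => hpr i n
    filter_upwards [hev, eventually_gt_atTop (Nat.find hex)] with k hk hlt
    rw [hEdef]
    dsimp only
    rw [firstSome_eq_some hlt (b := u)]
    · rfl
    · rw [hk _ le_rfl, hu]
    · intro m hm
      rw [hk m hm.le]
      simpa using Nat.find_min hex hm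
  choose E' hE1 hE2 hE3 using hlim
  refine ⟨chainPoint E' w, chainPoint_mem hE1 w 0, ?_, fun k => chainPoint (E k) w, ?_, ?_⟩
  · rw [← Set.notMem_compl_iff, hA, Set.mem_iUnion]
    rintro ⟨i, hi⟩
    rw [hS i] at hi
    exact chainPoint_notMem_negClosed hE1 hE2 w i hi
  · refine computable_chainPoint ?_ w
    have hv : Computable fun b : (ℕ × ℕ) × List Bool => b.2 ++ [false] :=
      Computable.list_concat.comp Computable.snd (Computable.const false)
    refine Computable.option_getD (computable_firstSome
      (f := fun (b : (ℕ × ℕ) × List Bool) n => meet (p b.1.2 b.1.1 n) (b.2 ++ [false]))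
      ?_ (Computable.fst.comp Computable.fst)) hv
    have h0 : Computable fun s : ((ℕ × ℕ) × List Bool) × ℕ => (s.1.1.2, s.1.1.1, s.2) :=
      Computable.pair (Computable.snd.comp (Computable.fst.comp Computable.fst))
        (Computable.pair (Computable.fst.comp (Computable.fst.comp Computable.fst)) Computable.snd)
    have h1 := hp.comp h0
    exact computable_meet.comp h1 (hv.comp Computable.fst)
  · intro n
    have : ∀ i, ∀ᶠ k in atTop, chain (E k) w i = chain E' w i := by
      intro i
      induction i with
      | zero => exact Eventually.of_forall fun _ => rfl
      | succ i ih =>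
        filter_upwards [ih, hE3 i (chain E' w i)] with k h1 h2
        change E k i (chain (E k) w i) = E' i (chain E' w i)
        rw [h1, h2]
    filter_upwards [this (n + 1)] with k hk
    rw [chainPoint, hk]
    rfl

lemma CEComeager.oneGeneric_mem {A : Set (ℕ → Bool)} (h : CEComeager A) {p : ℕ → Bool}
    (hp : OneGeneric p) : p ∈ A := by
  obtain ⟨S, ⟨f, hf, hS⟩, hn, hA⟩ := h
  rw [← Set.notMem_compl_iff, hA, Set.mem_iUnion]
  rintro ⟨i, hi⟩
  have hce : CEOpen (⋃ n, basicOpen (f i n)) :=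
    ⟨f i, (show Computable₂ f from hf).comp (Computable.const i) Computable.id, rfl⟩
  have hd := dense_iUnion_basicOpen (hS i ▸ hn i)
  obtain ⟨w, hw, h | h⟩ := oneGeneric_iff.1 hp _ hce
  · rw [hS i, negClosed] at hi
    exact hi (h hw)
  · exact ((dense_iff_cylinder.1 hd w).ne_empty h).elim

/-! ### A co-c.e. comeager set of 1-generic points -/

/-- Within `w.length` steps of the enumeration, the cylinder of `w` has been seen to be contained in
the `e`-th c.e. open set. -/
def settled (e : ℕ) (w : List Bool) : Bool :=
  (List.range w.length).any fun m => covers (ceName e m) w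

/-- The words that are settled with respect to the `e`-th c.e. open set although their
predecessors are not. They form an antichain, and their cylinders partition this set. -/
def minimallySettled (e : ℕ) (w : List Bool) : Bool :=
  settled e w && !settled e (w.take (w.length - 1))

lemma settled_iff {e : ℕ} {w : List Bool} :
    settled e w = true ↔ ∃ m < w.length, covers (ceName e m) w = true := by
  simp [settled]

lemma settled_mono {e : ℕ} {u w : List Bool} (h : u <+: w) (hu : settled e u = true) :
    settled e w = true := by
  obtain ⟨m, hm, hc⟩ := settled_iff.1 hu
  exact settled_iff.2 ⟨m, hm.trans_le h.length_le, covers_mono h hc⟩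

lemma cylinder_subset_of_settled {e : ℕ} {w : List Bool} (h : settled e w = true) :
    cylinder w ⊆ ceOpen e := by
  obtain ⟨m, -, hc⟩ := settled_iff.1 h
  exact (cylinder_subset_of_covers hc).trans (Set.subset_iUnion_of_subset m subset_rfl)

lemma computable_settled : Computable₂ settled := by
  refine computable_any (f := fun (a : ℕ × List Bool) m => covers (ceName a.1 m) a.2) ?_
    (Computable.list_length.comp Computable.snd)
  exact computable_covers.comp (computable_ceName.comp (Computable.fst.comp Computable.fst)
    Computable.snd) (Computable.snd.comp Computable.fst)

lemma computable_minimallySettled : Computable₂ minimallySettled := by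
  refine (Primrec.and.to_comp).comp computable_settled
    ((Primrec.not.to_comp).comp (computable_settled.comp Computable.fst ?_))
  exact (Primrec.list_take.to_comp).comp (Computable.pred.comp
    (Computable.list_length.comp Computable.snd)) Computable.snd

lemma take_initial (x : ℕ → Bool) {j k : ℕ} (h : j ≤ k) :
    (initial x k).take j = initial x j := by
  have := (List.prefix_iff_eq_take.1 (initial_prefix_initial x h)).symm
  rwa [length_initial] at this

/-- Every point of a c.e. open set has a minimally settled prefix. -/
lemma exists_minimallySettled {e : ℕ} {x : ℕ → Bool} (hx : x ∈ ceOpen e) :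
    ∃ w, x ∈ cylinder w ∧ minimallySettled e w = true := by
  obtain ⟨m, hm⟩ := Set.mem_iUnion.1 hx
  have hex : ∃ k, settled e (initial x k) = true := by
    cases hu : ceName e m with
    | none => simp [hu, basicOpen] at hm
    | some u =>
      rw [hu] at hm
      refine ⟨max (m + 1) u.length, settled_iff.2 ⟨m, ?_, covers_iff.2 ⟨u, hu, ?_⟩⟩⟩
      · rw [length_initial]
        omega
      · exact prefix_initial hm (le_max_right _ _)
  classical
  refine ⟨initial x (Nat.find hex), mem_cylinder_initial _ _, ?_⟩
  rw [minimallySettled, Nat.find_spec hex, Bool.true_and, length_initial,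
    take_initial x (Nat.sub_le _ _), Bool.not_eq_true']
  have hpos : 0 < Nat.find hex := by
    rw [Nat.find_pos]
    simp [settled, initial]
  simpa using Nat.find_min hex (Nat.sub_lt hpos one_pos)

lemma eq_of_minimallySettled {e : ℕ} {u w : List Bool} (hu : minimallySettled e u = true)
    (hw : minimallySettled e w = true) (h : u <+: w) : u = w := by
  rw [minimallySettled, Bool.and_eq_true, Bool.not_eq_true'] at hu hw
  by_contra hne
  have hlt : u.length < w.length :=
    lt_of_le_of_ne h.length_le fun heq => hne (h.eq_of_length heq)
  have : u <+: w.take (w.length - 1) := by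
    rw [List.prefix_take_iff]
    exact ⟨h, by omega⟩
  rw [settled_mono this hu.1] at hw
  simp at hw

/-- One point for each cylinder of a partition of the `e`-th c.e. open set. -/
def markers (e : ℕ) : Set (ℕ → Bool) :=
  {y | ∃ w, minimallySettled e w = true ∧ y = padded false w}

/-- The markers accumulate at every boundary point, since each neighbourhood of a boundary point
contains one of the cylinders that partition the c.e. open set. -/
lemma frontier_subset_closure_markers (e : ℕ) : frontier (ceOpen e) ⊆ closure (markers e) := by
  intro x hx
  rw [(isOpen_ceOpen e).frontier_eq] at hx
  rw [mem_closure_iff_initial]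
  intro k
  obtain ⟨y, hy, hyU⟩ := mem_closure_iff_initial.1 hx.1 k
  obtain ⟨w, hw, hmin⟩ := exists_minimallySettled hyU
  refine ⟨padded false w, ?_, w, hmin, rfl⟩
  rcases le_total w.length k with h | h
  · -- otherwise `x` itself would belong to the open set
    have hp : w <+: initial x k := prefix_of_mem_cylinder hw hy (by simpa using h)
    have : settled e w = true := (Bool.and_eq_true _ _ ▸ hmin : _ ∧ _).1
    exact (hx.2 (cylinder_subset_of_settled this (cylinder_subset_of_prefix hp
      (mem_cylinder_initial x k)))).elim
  · exact cylinder_subset_of_prefix (prefix_of_mem_cylinder hy hw (by simpa using h))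
      (padded_mem false w)

/-- The closure of the markers contains only one point of each cylinder of the partition. Hence it
contains no open subset of the c.e. open set, and it does not reach beyond its closure. -/
lemma isNowhereDense_closure_markers (e : ℕ) : IsNowhereDense (closure (markers e)) := by
  rw [isClosed_closure.isNowhereDense_iff]
  by_contra hne
  obtain ⟨x, hx⟩ := Set.nonempty_iff_ne_empty.2 hne
  obtain ⟨y, hy, u, hu, rfl⟩ := mem_closure_iff.1 (interior_subset hx) _ isOpen_interior hx
  have hex : ∃ k, cylinder (initial (padded false u) k) ⊆
      interior (closure (markers e)) ∩ cylinder u :=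
    exists_cylinder_subset (isOpen_interior.inter (isOpen_cylinder u)) ⟨hy, padded_mem false u⟩
  obtain ⟨k, hk⟩ := hex
  -- a point of the cylinder that differs from the marker behind position `k`
  set z : ℕ → Bool := fun n => if n = k then !padded false u k else padded false u n with hz
  have hzk : z ∈ cylinder (initial (padded false u) k) := by
    rw [mem_cylinder_initial_iff]
    intro i hi
    rw [hz]
    exact if_neg hi.ne
  obtain ⟨-, hzu⟩ := hk hzk
  have hzc := interior_subset (hk hzk).1
  obtain ⟨_, ⟨hv1, hv2⟩, v, hv, rfl⟩ := mem_closure_iff.1 hzc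
    (cylinder u ∩ cylinder (initial z (k + 1)))
    ((isOpen_cylinder u).inter (isOpen_cylinder _)) ⟨hzu, mem_cylinder_initial z (k + 1)⟩
  have huv : u = v := by
    rcases le_total u.length v.length with h | h
    · exact eq_of_minimallySettled hu hv (prefix_of_mem_cylinder hv1 (padded_mem false v) h)
    · exact (eq_of_minimallySettled hv hu
        (prefix_of_mem_cylinder (padded_mem false v) hv1 h)).symm
  subst huv
  have := mem_cylinder_initial_iff.1 hv2 k (Nat.lt_succ_self k)
  simp [hz] at this

lemma exists_coCEComeager_oneGeneric :
    ∃ C : Set (ℕ → Bool), CoCEComeager C ∧ ∀ p ∈ C, OneGeneric p := by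
  refine ⟨(⋃ e, closure (markers e))ᶜ, ⟨fun e => closure (markers e),
    ⟨fun e n => minimallySettled e (wordOf n), fun _ n => padded false (wordOf n), ?_, ?_, ?_⟩,
    isNowhereDense_closure_markers, compl_compl _⟩, ?_⟩
  · exact computable_minimallySettled.comp Computable.fst (computable_wordOf.comp Computable.snd)
  · exact ((Primrec.list_getD false).to_comp).comp (computable_wordOf.comp (Computable.fst.comp
      Computable.snd)) (Computable.snd.comp Computable.snd)
  · intro e
    refine congrArg closure (Set.ext fun y => ?_)
    dsimp only
    constructor
    · rintro ⟨w, hw, rfl⟩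
      exact ⟨Encodable.encode w, by rwa [wordOf_encode], by rw [wordOf_encode]⟩
    · rintro ⟨n, hn, rfl⟩
      exact ⟨wordOf n, hn, rfl⟩
  · intro p hp
    rw [oneGeneric_iff_frontier]
    exact fun e he => hp (Set.mem_iUnion.2 ⟨e, frontier_subset_closure_markers e he⟩)

/-! ### The set of non-computable points -/

section Noncomputable

open Nat.Partrec (Code)

/-- The bit `j` of the point whose bits are computed by the program with code `e` for as long as the
computations on `0, 1, …, j` finish within `n` steps, and are `false` from then on. -/
def stagePoint (e n j : ℕ) : Bool :=
  !(List.range (j + 1)).any (fun i => (Code.evaln n (Denumerable.ofNat Code e) i).isNone) &&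
    decide (Code.evaln n (Denumerable.ofNat Code e) j = some 1)

open Classical in
/-- The limit of the points `stagePoint e n` for `n → ∞`. -/
noncomputable def programPoint (e j : ℕ) : Bool :=
  decide ((∀ i ≤ j, (Code.eval (Denumerable.ofNat Code e) i).Dom) ∧
    1 ∈ Code.eval (Denumerable.ofNat Code e) j)

lemma programPoint_eq_true_iff {e j : ℕ} : programPoint e j = true ↔
    (∀ i ≤ j, (Code.eval (Denumerable.ofNat Code e) i).Dom) ∧
      1 ∈ Code.eval (Denumerable.ofNat Code e) j := by
  classical exact decide_eq_true_iff

lemma computable_stagePoint : Computable fun t : ℕ × ℕ × ℕ => stagePoint t.1 t.2.1 t.2.2 := by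
  have h0 : Computable fun s : (ℕ × ℕ × ℕ) × ℕ => ((s.1.2.1, s.1.1), s.2) :=
    Computable.pair (Computable.pair (Computable.fst.comp (Computable.snd.comp Computable.fst))
      (Computable.fst.comp Computable.fst)) Computable.snd
  have h1 := computable_evaln.comp h0
  have h2 : Computable fun t : ℕ × ℕ × ℕ => ((t.2.1, t.1), t.2.2) :=
    Computable.pair (Computable.pair (Computable.fst.comp Computable.snd) Computable.fst)
      (Computable.snd.comp Computable.snd)
  have h3 := computable_evaln.comp h2
  have h4 : Computable₂ fun (t : ℕ × ℕ × ℕ) i =>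
      (Code.evaln t.2.1 (Denumerable.ofNat Code t.1) i).isNone := by
    refine ((Primrec.not.to_comp).comp ((Primrec.option_isSome.to_comp).comp h1)).of_eq ?_
    intro a
    exact Option.not_isSome _
  have h5 := (Primrec.eq (α := Option ℕ)).decide.to_comp.comp h3 (Computable.const (some 1))
  exact (Primrec.and.to_comp).comp ((Primrec.not.to_comp).comp (computable_any h4
    (Computable.succ.comp (Computable.snd.comp Computable.snd)))) h5

lemma stagePoint_eq_true_iff {e n j : ℕ} : stagePoint e n j = true ↔
    (∀ i ≤ j, ∃ y, Code.evaln n (Denumerable.ofNat Code e) i = some y) ∧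
      Code.evaln n (Denumerable.ofNat Code e) j = some 1 := by
  simp only [stagePoint, Bool.and_eq_true, Bool.not_eq_true', List.any_eq_false, List.mem_range,
    Nat.lt_succ_iff, Option.isNone_iff_eq_none, decide_eq_true_eq, ← Option.ne_none_iff_exists',
    ne_eq]

lemma computable_stagePoint_apply (e n : ℕ) : Computable (stagePoint e n) := by
  have h0 : Computable fun j : ℕ => (e, n, j) :=
    Computable.pair (Computable.const e) (Computable.pair (Computable.const n) Computable.id)
  exact computable_stagePoint.comp h0

lemma eventually_evaln {c : Code} {i y : ℕ} (h : y ∈ c.eval i) :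
    ∀ᶠ n in atTop, c.evaln n i = some y := by
  obtain ⟨k, hk⟩ := Code.evaln_complete.1 h
  filter_upwards [eventually_ge_atTop k] with n hn
  exact Code.evaln_mono hn hk

lemma eventually_stagePoint (e j : ℕ) : ∀ᶠ n in atTop, stagePoint e n j = programPoint e j := by
  by_cases h : ∀ i ≤ j, (Code.eval (Denumerable.ofNat Code e) i).Dom
  · have h1 : ∀ᶠ n in atTop, ∀ i ≤ j, ∃ y ∈ Code.eval (Denumerable.ofNat Code e) i,
        Code.evaln n (Denumerable.ofNat Code e) i = some y := by
      refine (Set.finite_Iic j).eventually_all.2 fun i hi => ?_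
      filter_upwards [eventually_evaln (Part.get_mem (h i hi))] with n hn
      exact ⟨_, Part.get_mem (h i hi), hn⟩
    filter_upwards [h1] with n hn
    rw [Bool.eq_iff_iff, stagePoint_eq_true_iff, programPoint_eq_true_iff]
    obtain ⟨y, hy, hny⟩ := hn j le_rfl
    constructor
    · rintro ⟨-, h'⟩
      exact ⟨h, Code.evaln_sound h'⟩
    · rintro ⟨-, h'⟩
      refine ⟨fun i hi => (hn i hi).imp fun _ hz => hz.2, ?_⟩
      rw [hny, Part.mem_unique hy h']
  · refine Eventually.of_forall fun n => ?_
    rw [Bool.eq_iff_iff, stagePoint_eq_true_iff, programPoint_eq_true_iff]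
    refine iff_of_false (fun h' => h fun i hi => ?_) fun h' => h h'.1
    obtain ⟨y, hy⟩ := h'.1 i hi
    exact Part.dom_iff_mem.2 ⟨y, Code.evaln_sound hy⟩

lemma tendsto_stagePoint (e : ℕ) : Tendsto (stagePoint e) atTop (𝓝 (programPoint e)) := by
  rw [tendsto_pi_nhds]
  intro j
  rw [nhds_discrete, tendsto_pure]
  exact eventually_stagePoint e j

/-- If some computation of the program diverges, then the limit is attained at a finite stage. -/
lemma computable_programPoint (e : ℕ) : Computable (programPoint e) := by
  by_cases h : ∀ i, (Code.eval (Denumerable.ofNat Code e) i).Dom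
  · have h1 : Computable fun i => (Code.eval (Denumerable.ofNat Code e) i).get (h i) :=
      (Partrec.nat_iff.2 (Code.exists_code.2 ⟨_, rfl⟩)).of_eq_tot fun i => Part.get_mem (h i)
    refine ((Primrec.eq (α := ℕ)).decide.to_comp.comp h1 (Computable.const 1)).of_eq fun i => ?_
    rw [Bool.eq_iff_iff, decide_eq_true_eq, programPoint_eq_true_iff]
    exact ⟨fun hi => ⟨fun j _ => h j, hi ▸ Part.get_mem (h i)⟩, fun hi => Part.get_eq_of_mem hi.2 _⟩
  · push Not at h
    obtain ⟨i, hi⟩ := h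
    obtain ⟨n, hn⟩ :=
      ((Set.finite_Iio i).eventually_all.2 fun j _ => eventually_stagePoint e j).exists
    refine (computable_stagePoint_apply e n).of_eq fun j => ?_
    rcases lt_or_ge j i with hj | hj
    · exact hn j hj
    · rw [Bool.eq_iff_iff, stagePoint_eq_true_iff, programPoint_eq_true_iff]
      refine iff_of_false (fun h' => hi ?_) fun h' => hi (h'.1 i hj)
      obtain ⟨y, hy⟩ := h'.1 i hj
      exact Part.dom_iff_mem.2 ⟨y, Code.evaln_sound hy⟩

lemma exists_programPoint_eq {p : ℕ → Bool} (hp : Computable p) : ∃ e, programPoint e = p := by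
  have h1 : Computable fun n => (p n).toNat :=
    ((Primrec.dom_bool Bool.toNat).to_comp).comp hp
  obtain ⟨c, hc⟩ := Code.exists_code.1 (Partrec.nat_iff.1 h1.partrec)
  refine ⟨Encodable.encode c, funext fun j => ?_⟩
  rw [Bool.eq_iff_iff, programPoint_eq_true_iff, Denumerable.ofNat_encode, hc]
  cases hj : p j <;> simp [hj]

lemma closure_range_stagePoint (e : ℕ) :
    closure (Set.range (stagePoint e)) = insert (programPoint e) (Set.range (stagePoint e)) := by
  refine subset_antisymm (closure_minimal (Set.subset_insert _ _)
    (tendsto_stagePoint e).isCompact_insert_range.isClosed)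
    (Set.insert_subset ?_ subset_closure)
  exact mem_closure_of_tendsto (tendsto_stagePoint e) (Eventually.of_forall fun n => ⟨n, rfl⟩)

lemma interior_eq_empty_of_countable {S : Set (ℕ → Bool)} (hS : S.Countable) :
    interior S = ∅ := by
  by_contra hne
  obtain ⟨x, hx⟩ := Set.nonempty_iff_ne_empty.2 hne
  obtain ⟨k, hk⟩ := exists_cylinder_subset isOpen_interior hx
  set g : (ℕ → Bool) → ℕ → Bool := fun y n => if n < k then x n else y (n - k) with hg
  have hinj : Function.Injective g := by
    intro y z hyz
    funext n
    simpa [hg] using congrFun hyz (n + k)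
  have : (g ⁻¹' S).Countable := hS.preimage hinj
  have huniv : g ⁻¹' S = Set.univ := by
    refine Set.eq_univ_of_forall fun y => interior_subset (s := S) (hk ?_)
    rw [mem_cylinder_initial_iff]
    exact fun i hi => if_pos hi
  rw [huniv, Set.countable_univ_iff] at this
  obtain ⟨f, hf⟩ := exists_surjective_nat (ℕ → Bool)
  obtain ⟨n, hn⟩ := hf fun n => !f n n
  simpa using congrFun hn n

lemma coCEComeager_noncomputable : CoCEComeager {p : ℕ → Bool | ¬ Computable p} := by
  refine ⟨fun e => closure (Set.range (stagePoint e)), ⟨fun _ _ => true, stagePoint,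
    Computable.const _, computable_stagePoint, fun e => ?_⟩, fun e => ?_, ?_⟩
  · refine congrArg closure (Set.ext fun y => ?_)
    simp [eq_comm]
  · rw [isClosed_closure.isNowhereDense_iff, closure_range_stagePoint]
    exact interior_eq_empty_of_countable ((Set.countable_range _).insert _)
  · ext p
    rw [Set.mem_compl_iff, Set.mem_iUnion]
    constructor
    · intro h
      obtain ⟨e, rfl⟩ := exists_programPoint_eq (not_not.1 h)
      exact ⟨e, by rw [closure_range_stagePoint]; exact Set.mem_insert _ _⟩
    · rintro ⟨e, he⟩ h
      rw [closure_range_stagePoint] at he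
      rcases he with rfl | ⟨n, rfl⟩
      · exact h (computable_programPoint e)
      · exact h (computable_stagePoint_apply e n)

end Noncomputable

/-! ### 1-generic points do not have minimal degree -/

/-- `F σ` computes from the finite part `σ` of the oracle `q` a part of the function `f`, and
every value of `f` is computed from all sufficiently long prefixes of `q`. -/
def Approximates (F : List Bool → ℕ →. ℕ) (q : ℕ → Bool) (f : ℕ →. ℕ) : Prop :=
  (∀ k n y, y ∈ F (initial q k) n → y ∈ f n) ∧
    ∀ n y, y ∈ f n → ∀ᶠ k in atTop, y ∈ F (initial q k) n

lemma exists_approximates_of_partrec {f : ℕ →. ℕ} (hf : Nat.Partrec f) (q : ℕ → Bool) :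
    ∃ F, Partrec₂ F ∧ Approximates F q f :=
  ⟨fun _ n => f n, (Partrec.nat_iff.2 hf).comp Computable.snd, fun _ _ _ h => h,
    fun _ _ h => Eventually.of_forall fun _ => h⟩

lemma mem_map_pair {a b : Part ℕ} {y : ℕ} :
    y ∈ (Nat.pair <$> a <*> b) ↔ ∃ u ∈ a, ∃ v ∈ b, Nat.pair u v = y := by
  simp [Seq.seq]

/-- The use principle: a computation with oracle `q` consults only a finite part of `q`. -/
lemma exists_approximates {q : ℕ → Bool} {f : ℕ →. ℕ} (hf : Nat.RecursiveIn {oracle q} f) :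
    ∃ F, Partrec₂ F ∧ Approximates F q f := by
  induction hf with
  | zero => exact exists_approximates_of_partrec .zero q
  | succ => exact exists_approximates_of_partrec .succ q
  | left => exact exists_approximates_of_partrec .left q
  | right => exact exists_approximates_of_partrec .right q
  | oracle g hg =>
    rw [Set.mem_singleton_iff] at hg
    subst hg
    refine ⟨fun σ n => ((σ[n]?.map Bool.toNat : Option ℕ) : Part ℕ), ?_, ?_, ?_⟩
    · exact Computable.ofOption (Computable.option_map (Computable.list_getElem?)
        (((Primrec.dom_bool Bool.toNat).to_comp).comp Computable.snd))
    · intro k n y h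
      rw [Part.mem_ofOption, Option.mem_def, Option.map_eq_some_iff] at h
      obtain ⟨b, hb, rfl⟩ := h
      have hn : n < k := by
        by_contra hn
        rw [List.getElem?_eq_none (by simpa using hn)] at hb
        simp at hb
      rw [initial_getElem? q hn, Option.some.injEq] at hb
      subst hb
      exact Part.mem_some _
    · intro n y h
      rw [oracle, Part.mem_some_iff] at h
      subst h
      filter_upwards [eventually_gt_atTop n] with k hk
      rw [initial_getElem? q hk]
      simp
  | @pair f h _ _ ihf ihh =>
    obtain ⟨F, hF, hF1, hF2⟩ := ihf
    obtain ⟨H, hH, hH1, hH2⟩ := ihh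
    refine ⟨fun σ n => (F σ n).bind fun u => (H σ n).map (Nat.pair u), ?_, ?_, ?_⟩
    · exact Partrec.bind hF (Partrec.map (hH.comp (Computable.fst.comp Computable.fst)
        (Computable.snd.comp Computable.fst)) ((Primrec₂.natPair.to_comp).comp
          (Computable.snd.comp Computable.fst) Computable.snd))
    · intro k n y h
      obtain ⟨u, hu, h⟩ := Part.mem_bind_iff.1 h
      obtain ⟨v, hv, h⟩ := (Part.mem_map_iff _).1 h
      exact mem_map_pair.2 ⟨u, hF1 k n u hu, v, hH1 k n v hv, h⟩
    · intro n y h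
      obtain ⟨u, hu, v, hv, h⟩ := mem_map_pair.1 h
      filter_upwards [hF2 n u hu, hH2 n v hv] with k h1 h2
      exact Part.mem_bind_iff.2 ⟨u, h1, (Part.mem_map_iff _).2 ⟨v, h2, h⟩⟩
  | @comp f h _ _ ihf ihh =>
    obtain ⟨F, hF, hF1, hF2⟩ := ihf
    obtain ⟨H, hH, hH1, hH2⟩ := ihh
    refine ⟨fun σ n => (H σ n).bind (F σ), ?_, ?_, ?_⟩
    · exact Partrec.bind hH (hF.comp (Computable.fst.comp Computable.fst) Computable.snd)
    · intro k n y h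
      obtain ⟨u, hu, h⟩ := Part.mem_bind_iff.1 h
      exact Part.mem_bind_iff.2 ⟨u, hH1 k n u hu, hF1 k u y h⟩
    · intro n y h
      obtain ⟨u, hu, h⟩ := Part.mem_bind_iff.1 h
      filter_upwards [hH2 n u hu, hF2 u y h] with k h1 h2
      exact Part.mem_bind_iff.2 ⟨u, h1, h2⟩
  | @prec f h _ _ ihf ihh =>
    obtain ⟨F, hF, hF1, hF2⟩ := ihf
    obtain ⟨H, hH, hH1, hH2⟩ := ihh
    refine ⟨fun σ n => (n.unpair.2).rec (F σ n.unpair.1) fun y IH =>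
      IH.bind fun i => H σ (Nat.pair n.unpair.1 (Nat.pair y i)), ?_, ?_, ?_⟩
    · have hn : Computable fun a : List Bool × ℕ => a.2.unpair.1 :=
        Computable.fst.comp (Computable.unpair.comp Computable.snd)
      have h1 : Partrec fun a : List Bool × ℕ => F a.1 a.2.unpair.1 :=
        hF.comp Computable.fst hn
      have h2 : Partrec fun b : (List Bool × ℕ) × ℕ × ℕ =>
          H b.1.1 (Nat.pair b.1.2.unpair.1 (Nat.pair b.2.1 b.2.2)) :=
        hH.comp (Computable.fst.comp Computable.fst) ((Primrec₂.natPair.to_comp).comp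
          (hn.comp Computable.fst) ((Primrec₂.natPair.to_comp).comp
            (Computable.fst.comp Computable.snd) (Computable.snd.comp Computable.snd)))
      have h3 : Partrec₂ fun (a : List Bool × ℕ) (b : ℕ × ℕ) =>
          H a.1 (Nat.pair a.2.unpair.1 (Nat.pair b.1 b.2)) := h2
      exact Partrec.nat_rec (Computable.snd.comp (Computable.unpair.comp Computable.snd)) h1 h3
    · intro k n
      dsimp only
      induction n.unpair.2 with
      | zero => exact fun y h => hF1 k _ y h
      | succ m ih =>
        intro y h
        obtain ⟨i, hi, h⟩ := Part.mem_bind_iff.1 h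
        exact Part.mem_bind_iff.2 ⟨i, ih i hi, hH1 k _ y h⟩
    · intro n
      dsimp only
      induction n.unpair.2 with
      | zero => exact fun y h => hF2 _ y h
      | succ m ih =>
        intro y h
        obtain ⟨i, hi, h⟩ := Part.mem_bind_iff.1 h
        filter_upwards [ih i hi, hH2 _ y h] with k h1 h2
        exact Part.mem_bind_iff.2 ⟨i, h1, h2⟩
  | @rfind f _ ihf =>
    obtain ⟨F, hF, hF1, hF2⟩ := ihf
    refine ⟨fun σ n => Nat.rfind fun m => (F σ (Nat.pair n m)).map fun y => decide (y = 0),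
      ?_, ?_, ?_⟩
    · have h1 : Partrec fun b : (List Bool × ℕ) × ℕ => F b.1.1 (Nat.pair b.1.2 b.2) :=
        hF.comp (Computable.fst.comp Computable.fst) ((Primrec₂.natPair.to_comp).comp
          (Computable.snd.comp Computable.fst) Computable.snd)
      have h2 : Computable₂ fun (_ : (List Bool × ℕ) × ℕ) (y : ℕ) => decide (y = 0) :=
        ((Primrec.eq (α := ℕ)).decide.to_comp).comp Computable.snd (Computable.const 0)
      exact Partrec.rfind (h1.map h2)
    · intro k n y h
      obtain ⟨h1, h2⟩ := Nat.mem_rfind.1 h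
      refine Nat.mem_rfind.2 ⟨?_, fun {m} hm => ?_⟩
      · obtain ⟨z, hz, hz'⟩ := (Part.mem_map_iff _).1 h1
        exact (Part.mem_map_iff _).2 ⟨z, hF1 k _ z hz, hz'⟩
      · obtain ⟨z, hz, hz'⟩ := (Part.mem_map_iff _).1 (h2 hm)
        exact (Part.mem_map_iff _).2 ⟨z, hF1 k _ z hz, hz'⟩
    · intro n y h
      obtain ⟨h1, h2⟩ := Nat.mem_rfind.1 h
      have hev : ∀ m (b : Bool), b ∈ (f (Nat.pair n m)).map (fun z => decide (z = 0)) →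
          ∀ᶠ k in atTop, b ∈ (F (initial q k) (Nat.pair n m)).map fun z => decide (z = 0) := by
        intro m b hb
        obtain ⟨z, hz, hz'⟩ := (Part.mem_map_iff _).1 hb
        filter_upwards [hF2 _ z hz] with k hk
        exact (Part.mem_map_iff _).2 ⟨z, hk, hz'⟩
      filter_upwards [hev y true h1,
        (Set.finite_Iio y).eventually_all.2 fun m hm => hev m false (h2 hm)] with k h3 h4
      exact Nat.mem_rfind.2 ⟨h3, fun {m} hm => h4 m hm⟩

/-- The sequence of the bits at even positions. -/
def evenPart (p : ℕ → Bool) (n : ℕ) : Bool := p (2 * n)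

lemma turingReducible_evenPart (p : ℕ → Bool) :
    TuringReducible (oracle (evenPart p)) (oracle p) := by
  rw [TuringReducible, RecursiveIn.iff_nat]
  have h1 : Nat.RecursiveIn {oracle p} fun n => (Part.some (2 * n) : Part ℕ) :=
    (Partrec.nat_iff.1 ((Primrec.nat_mul.to_comp).comp (Computable.const 2)
      Computable.id).partrec).recursiveIn
  exact (Nat.RecursiveIn.comp (.oracle _ (Set.mem_singleton _)) h1).of_eq
    fun n => Part.bind_some _ _

/-- If the even part were computable, then some prefix of the point would force every extension to
agree with it at the even positions. -/
lemma OneGeneric.not_computable_evenPart {p : ℕ → Bool} (hp : OneGeneric p) :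
    ¬ Computable (evenPart p) := by
  intro hc
  set F : List Bool × ℕ →. List Bool := fun a =>
    ((bif decide (a.1[2 * a.2]? = some (!evenPart p a.2)) then some a.1 else none :
      Option (List Bool)) : Part (List Bool)) with hF
  have hFp : Partrec F := by
    have h1 : Computable fun a : List Bool × ℕ => a.1[2 * a.2]? :=
      Computable.list_getElem?.comp Computable.fst
        ((Primrec.nat_mul.to_comp).comp (Computable.const 2) Computable.snd)
    have h2 : Computable fun a : List Bool × ℕ => some (!evenPart p a.2) :=
      Computable.option_some.comp ((Primrec.not.to_comp).comp (hc.comp Computable.snd))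
    have h3 := ((Primrec.eq (α := Option Bool)).decide.to_comp).comp h1 h2
    exact Computable.ofOption (Computable.cond h3 (Computable.option_some.comp Computable.fst)
      (Computable.const none))
  have hmem : ∀ a w, w ∈ F a ↔ a.1[2 * a.2]? = some (!evenPart p a.2) ∧ a.1 = w := by
    intro a w
    by_cases h : a.1[2 * a.2]? = some (!evenPart p a.2)
    · simp [hF, h, eq_comm]
    · simp [hF, h]
  obtain ⟨w, hw, h⟩ := oneGeneric_iff.1 hp _ (ceOpen_of_partrec hFp)
  rcases h with h | h
  · obtain ⟨⟨v, n⟩, v', hv', hpv⟩ := h hw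
    obtain ⟨hv, rfl⟩ := (hmem _ _).1 hv'
    dsimp only at hv hpv
    have hlt : 2 * n < v.length := by
      by_contra hlt
      rw [List.getElem?_eq_none (by simpa using hlt)] at hv
      simp at hv
    rw [mem_cylinder_iff_getElem?.1 hpv _ hlt, evenPart] at hv
    simp at hv
  · -- flip an even position behind `w`
    set x : ℕ → Bool := fun i => if i = 2 * w.length then !p i else p i with hx
    have hxw : x ∈ cylinder w := by
      intro i hi
      rw [hx]
      dsimp only
      rw [if_neg (by omega)]
      exact hw i hi
    refine Set.eq_empty_iff_forall_notMem.1 h x ⟨hxw, (initial x (2 * w.length + 1), w.length),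
      _, (hmem _ _).2 ⟨?_, rfl⟩, mem_cylinder_initial _ _⟩
    rw [initial_getElem? x (Nat.lt_succ_self _)]
    simp [hx, evenPart]

/-- A 1-generic point `p` cannot be computed from its even part `q`: consider the c.e. open set of all
`x` that differ from the result of the given computation with the even part of `x` as oracle. It does
not contain `p`; but no prefix of `p` excludes it, since changing `p` at an odd position
does not affect the oracle. -/
lemma OneGeneric.not_turingReducible_evenPart {p : ℕ → Bool} (hp : OneGeneric p) :
    ¬ TuringReducible (oracle p) (oracle (evenPart p)) := by
  intro hred
  rw [TuringReducible, RecursiveIn.iff_nat] at hred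
  obtain ⟨Φ, hΦ, hΦ1, hΦ2⟩ := exists_approximates hred
  -- `(w, σ, n)` is a witness if `σ` consists of bits at even positions of `w` and the computation
  -- with oracle `σ` yields on input `n` a bit `y` such that the bit `n` of `w` is `1 - y`
  set good : List Bool × List Bool × ℕ → Bool := fun a =>
    !(List.range a.2.1.length).any fun i => !decide (a.1[2 * i]? = a.2.1[i]?) with hgood
  set F : List Bool × List Bool × ℕ →. List Bool := fun a => (Φ a.2.1 a.2.2).bind fun y =>
    ((bif good a && decide (a.1[a.2.2]?.map Bool.toNat = some (1 - y)) then some a.1 else none :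
      Option (List Bool)) : Part (List Bool)) with hF
  have hgoodc : Computable good := by
    have h1 : Computable fun b : (List Bool × List Bool × ℕ) × ℕ => b.1.1[2 * b.2]? :=
      Computable.list_getElem?.comp (Computable.fst.comp Computable.fst)
        ((Primrec.nat_mul.to_comp).comp (Computable.const 2) Computable.snd)
    have h2 : Computable fun b : (List Bool × List Bool × ℕ) × ℕ => b.1.2.1[b.2]? :=
      Computable.list_getElem?.comp (Computable.fst.comp (Computable.snd.comp Computable.fst))
        Computable.snd
    have h3 := (Primrec.not.to_comp).comp
      (((Primrec.eq (α := Option Bool)).decide.to_comp).comp h1 h2)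
    have h4 : Computable₂ fun (a : List Bool × List Bool × ℕ) i =>
      !decide (a.1[2 * i]? = a.2.1[i]?) := h3
    exact (Primrec.not.to_comp).comp (computable_any h4
      (Computable.list_length.comp (Computable.fst.comp Computable.snd)))
  have hFp : Partrec F := by
    have h1 : Partrec fun a : List Bool × List Bool × ℕ => Φ a.2.1 a.2.2 :=
      hΦ.comp (Computable.fst.comp Computable.snd) (Computable.snd.comp Computable.snd)
    have h2 : Computable fun b : (List Bool × List Bool × ℕ) × ℕ => b.1.1[b.1.2.2]? :=
      Computable.list_getElem?.comp (Computable.fst.comp Computable.fst)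
        (Computable.snd.comp (Computable.snd.comp Computable.fst))
    have h3 : Computable fun b : (List Bool × List Bool × ℕ) × ℕ =>
        b.1.1[b.1.2.2]?.map Bool.toNat :=
      Computable.option_map h2 (((Primrec.dom_bool Bool.toNat).to_comp).comp Computable.snd)
    have h4 : Computable fun b : (List Bool × List Bool × ℕ) × ℕ => some (1 - b.2) :=
      Computable.option_some.comp
        ((Primrec.nat_sub.to_comp).comp (Computable.const 1) Computable.snd)
    have h5 := ((Primrec.eq (α := Option ℕ)).decide.to_comp).comp h3 h4
    have h6 := (Primrec.and.to_comp).comp (hgoodc.comp Computable.fst) h5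
    exact h1.bind (Computable.ofOption (Computable.cond h6
      (Computable.option_some.comp (Computable.fst.comp Computable.fst)) (Computable.const none)))
  have hmem : ∀ a w, w ∈ F a ↔ ∃ y ∈ Φ a.2.1 a.2.2,
      (∀ i < a.2.1.length, a.1[2 * i]? = a.2.1[i]?) ∧
      a.1[a.2.2]?.map Bool.toNat = some (1 - y) ∧ a.1 = w := by
    intro a w
    have hg : good a = true ↔ ∀ i < a.2.1.length, a.1[2 * i]? = a.2.1[i]? := by
      simp [hgood]
    rw [hF, Part.mem_bind_iff]
    refine exists_congr fun y => and_congr_right fun _ => ?_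
    rw [← hg]
    by_cases h1 : good a = true <;>
      by_cases h2 : a.1[a.2.2]?.map Bool.toNat = some (1 - y) <;> simp [h1, h2, eq_comm]
  obtain ⟨w, hw, h⟩ := oneGeneric_iff.1 hp _ (ceOpen_of_partrec hFp)
  rcases h with h | h
  · obtain ⟨⟨v, σ, n⟩, v', hv', hpv⟩ := h hw
    obtain ⟨y, hy, hσ, hn, rfl⟩ := (hmem _ _).1 hv'
    dsimp only at hy hσ hn hpv
    have hsome : ∀ i (b : Bool), v[i]? = some b → b = p i := by
      intro i b hb
      have hi : i < v.length := by
        by_contra hi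
        rw [List.getElem?_eq_none (by simpa using hi)] at hb
        simp at hb
      rw [mem_cylinder_iff_getElem?.1 hpv i hi, Option.some.injEq] at hb
      exact hb.symm
    have hσq : initial (evenPart p) σ.length = σ := by
      rw [← mem_cylinder_iff_initial]
      intro i hi
      refine (hsome (2 * i) _ ?_).symm
      rw [hσ i hi, List.getElem?_eq_getElem hi]
    rw [← hσq] at hy
    have hyn := hΦ1 _ _ _ hy
    rw [oracle, Part.mem_some_iff] at hyn
    obtain ⟨b, hb, hby⟩ := Option.map_eq_some_iff.1 hn
    have hbp := hsome n b hb
    subst hbp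
    rw [hyn] at hby
    cases hpn : p n <;> simp [hpn] at hby
  · -- flip an odd position behind `w`, which leaves the oracle unchanged
    set n := 2 * w.length + 1 with hndef
    set x : ℕ → Bool := fun i => if i = n then !p i else p i with hx
    have hxw : x ∈ cylinder w := by
      intro i hi
      rw [hx]
      dsimp only
      rw [if_neg (by omega)]
      exact hw i hi
    obtain ⟨k, hk⟩ := (hΦ2 n (p n).toNat (Part.mem_some _)).exists
    refine Set.eq_empty_iff_forall_notMem.1 h x ⟨hxw,
      (initial x (2 * k + n + 1), initial (evenPart p) k, n), _,
      (hmem _ _).2 ⟨_, hk, ?_, ?_, rfl⟩, mem_cylinder_initial _ _⟩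
    · intro i hi
      rw [length_initial] at hi
      dsimp only
      rw [initial_getElem? x (by omega), initial_getElem? _ hi, hx]
      dsimp only
      rw [if_neg (by omega), evenPart]
    · dsimp only
      rw [initial_getElem? x (by omega)]
      cases hpn : p n <;> simp [hx, hpn]

lemma OneGeneric.not_hasMinimalDegree {p : ℕ → Bool} (hp : OneGeneric p) :
    ¬ HasMinimalDegree p := fun h =>
  (h.2 _ (turingReducible_evenPart p)).elim hp.not_computable_evenPart
    hp.not_turingReducible_evenPart

end EffCat

theorem corollary9p8 (A B : Set (ℕ → Bool)) :
    -- (1) the whole space, for Cantor space and for Baire space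
    (CEComeager (Set.univ : Set (ℕ → Bool)) ∧ CoCEComeager (Set.univ : Set (ℕ → Bool)) ∧
      CEComeagerInLimit (Set.univ : Set (ℕ → Bool)) ∧
      CEComeager (Set.univ : Set (ℕ → ℕ)) ∧ CoCEComeager (Set.univ : Set (ℕ → ℕ)) ∧
      CEComeagerInLimit (Set.univ : Set (ℕ → ℕ))) ∧
    -- (2)
    (CEComeager A →
      (∃ D : Set (ℕ → Bool), D ⊆ A ∧ Dense D ∧ ∀ p ∈ D, Computable p) ∧
      ∀ p, OneGeneric p → p ∈ A) ∧
    -- (3)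
    (CEComeagerInLimit A →
      ∃ D : Set (ℕ → Bool), D ⊆ A ∧ Dense D ∧ ∀ p ∈ D, OneGeneric p ∧ LimitComputable p) ∧
    -- (4)
    (CEComeager A → ∃ C : Set (ℕ → Bool), C ⊆ A ∧ CoCEComeager C) ∧
    -- (5)
    (CEComeager A ∨ CoCEComeager A → CEComeagerInLimit A) ∧
    -- (6)
    ((CEComeager A → CEComeager B → CEComeager (A ∩ B)) ∧
      (CoCEComeager A → CoCEComeager B → CoCEComeager (A ∩ B)) ∧
      (CEComeagerInLimit A → CEComeagerInLimit B → CEComeagerInLimit (A ∩ B))) ∧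
    -- (7)
    CEComeagerInLimit {p : ℕ → Bool | OneGeneric p} ∧
    -- (8)
    CoCEComeager {p : ℕ → Bool | ¬ Computable p} ∧
    -- (9)
    (∃ C : Set (ℕ → Bool), CoCEComeager C ∧ (∀ p ∈ C, OneGeneric p) ∧
      ∀ p ∈ C, ¬ HasMinimalDegree p) := by
  obtain ⟨C, hC, hCgen⟩ := exists_coCEComeager_oneGeneric
  refine ⟨⟨ceComeager_univ, coCEComeager_univ, ceComeager_univ.inLimit, ceComeager_univ,
    coCEComeager_univ, ceComeager_univ.inLimit⟩, fun hA => ⟨?_, fun p => hA.oneGeneric_mem⟩,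
    fun hA => ?_, fun hA => ⟨C, fun p hp => hA.oneGeneric_mem (hCgen p hp), hC⟩,
    fun hA => hA.elim CEComeager.inLimit CoCEComeager.inLimit,
    ⟨CEComeager.inter, CoCEComeager.inter, CEComeagerInLimit.inter⟩,
    ceComeagerInLimit_oneGeneric, coCEComeager_noncomputable,
    C, hC, hCgen, fun p hp => (hCgen p hp).not_hasMinimalDegree⟩
  · refine ⟨{p | p ∈ A ∧ Computable p}, fun p hp => hp.1, dense_iff_cylinder.2 fun w => ?_,
      fun p hp => hp.2⟩
    obtain ⟨x, hx, hxA, hxc⟩ := hA.exists_computable w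
    exact ⟨x, hx, hxA, hxc⟩
  · refine ⟨{p | p ∈ A ∧ OneGeneric p ∧ LimitComputable p}, fun p hp => hp.1,
      dense_iff_cylinder.2 fun w => ?_, fun p hp => hp.2⟩
    obtain ⟨x, hx, hxA, hxc⟩ :=
      (hA.inter ceComeagerInLimit_oneGeneric).exists_limitComputable w
    exact ⟨x, hx, hxA.1, hxA.2, hxc⟩
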